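/- Let $d>k\ge 1$ be integers. For a channel (completely positive trace-preserving map) $\Lambda$ between finite-dimensional matrix algebras, with Heisenberg dual $\Lambda^*$ defined by $\operatorname{tr}(\Lambda^*(E)X)=\operatorname{tr}(E\,\Lambda(X))$, say that $\Lambda$ is - *incompatibility breaking* if $\Lambda^*$ maps every finite family of finite-outcome POVMs $(M_{b|y})_b$ to a jointly measurable family, i.e. there are a POVM $(G_\lambda)_\lambda$ and conditional probabilities $p(b|y,\lambda)$ with $\Lambda^*(M_{b|y})=\sum_\lambda p(b|y,\lambda)\,G_\lambda$ for all $b,y$; - *$k$-partially entanglement breaking* if $(\mathrm{id}_r\otimes\Lambda)(\rho)$ has Schmidt number at most $k$ for every finite-dimensional reference system $\mathbb C^r$ and every joint input state $\rho$. Then there exists an incompatibility-breaking channel $\Lambda$ from $\mathbb C^d$ to $\mathbb C^{d+1}$ such that two copies of it, placed in parallel in a line network with trusted end points, are semi-device-independently certified not to be $k$-partially entanglement breaking, in the following sense. Let $\rho=(\mathrm{id}\otimes\Lambda)(|\psi_d^+\rangle\langle\psi_d^+|)$, where $\psi_d^+=d^{-1/2}\sum_{i}|ii\rangle$. There is a finite-outcome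 POVM $(M_b)_b$ on $\mathbb C^{d+1}\otimes\mathbb C^{d+1}$ such that the ensemble $$\sigma_b^{AC}=\operatorname{tr}_{BB'}\big[(\mathbb 1^{AC}\otimes M_b^{BB'})(\rho^{AB}\otimes\rho^{CB'})\big]$$ prepared at the end points $A,C$ (each $\mathbb C^d$) satisfies: 1. for some outcome $b$, $\operatorname{tr}\sigma_b\neq 0$ and the normalised state $\sigma_b/\operatorname{tr}\sigma_b$ has Schmidt number greater than $k$; 2. whenever arbitrary states $\omega_1$ on $A\otimes\mathbb C^{a}$ and $\omega_2$ on $C\otimes\mathbb C^{c}$, channels $\Lambda_1$ on $\mathbb C^{a}$ and $\Lambda_2$ on $\mathbb C^{c}$ with arbitrary finite-dimensional outputs, and an arbitrary joint POVM $(M'_b)_b$ on the two outputs prepare the same ensemble, i.e. $\sigma_b=\operatorname{tr}_{BB'}[(\mathbb 1\otimes M'_b)((\mathrm{id}_A\otimes\Lambda_1)(\omega_1)\otimes(\mathrm{id}_C\otimes\Lambda_2)(\omega_2))]$ for all $b$, neither $\Lambda_1$ nor $\Lambda_2$ is $k$-partially entanglement breaking. -/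

import Mathlib

open scoped Kronecker ComplexOrder

/-- A density matrix: a positive semidefinite matrix of trace one. -/
def IsDensityMatrix {a : Type*} [Fintype a] (ρ : Matrix a a ℂ) : Prop :=
  ρ.PosSemidef ∧ ρ.trace = 1

/-- A POVM with finitely many outcomes: positive semidefinite effects summing to the identity. -/
def IsPOVM {a o : Type*} [Fintype a] [DecidableEq a] [Fintype o] (M : o → Matrix a a ℂ) : Prop :=
  (∀ i, (M i).PosSemidef) ∧ ∑ i, M i = 1

/-- The map `id_r ⊗ Λ` on operators of the bipartite system `r × a`, acting by `Λ` on the blocks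
indexed by `r`. -/
def idTensor (r : Type*) {a b : Type*} (Λ : Matrix a a ℂ →ₗ[ℂ] Matrix b b ℂ)
    (X : Matrix (r × a) (r × a) ℂ) : Matrix (r × b) (r × b) ℂ :=
  Matrix.of fun i j => Λ (Matrix.of fun x y => X (i.1, x) (j.1, y)) i.2 j.2

/-- A quantum channel (Schrödinger picture): a completely positive, trace preserving linear map. -/
def IsChannel {a b : Type*} [Fintype a] [Fintype b]
    (Λ : Matrix a a ℂ →ₗ[ℂ] Matrix b b ℂ) : Prop :=
  (∀ (n : ℕ) (X : Matrix (Fin n × a) (Fin n × a) ℂ),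
      X.PosSemidef → (idTensor (Fin n) Λ X).PosSemidef) ∧
    ∀ X, (Λ X).trace = X.trace

/-- The Heisenberg-picture map `Λ*`, characterised by `tr (Λ*(E) X) = tr (E Λ(X))`
(see `trace_heisenberg_mul`). -/
def heisenberg {a b : Type*} [DecidableEq a] [Fintype b]
    (Λ : Matrix a a ℂ →ₗ[ℂ] Matrix b b ℂ) (E : Matrix b b ℂ) : Matrix a a ℂ :=
  Matrix.of fun i j => (E * Λ (Matrix.single j i 1)).trace

theorem trace_heisenberg_mul {a b : Type*} [Fintype a] [DecidableEq a] [Fintype b]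
    (Λ : Matrix a a ℂ →ₗ[ℂ] Matrix b b ℂ) (E : Matrix b b ℂ) (X : Matrix a a ℂ) :
    (heisenberg Λ E * X).trace = (E * Λ X).trace := by
  conv_rhs => rw [Matrix.matrix_eq_sum_single X]
  have h : ∀ i j, Matrix.single i j (X i j) = X i j • Matrix.single i j (1 : ℂ) := by
    intro i j
    rw [Matrix.smul_single, smul_eq_mul, mul_one]
  simp only [h, map_sum, map_smul, Matrix.mul_sum, Matrix.trace_sum, Matrix.mul_smul,
    Matrix.trace_smul, smul_eq_mul]
  rw [Finset.sum_comm]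
  simp [Matrix.trace, Matrix.diag, Matrix.mul_apply, heisenberg, mul_comm]

/-- Joint measurability (compatibility) of a family `N y` of finite-outcome measurements: all of
them are classical post-processings of one parent POVM `G`. -/
def JointlyMeasurable {a s o : Type*} [Fintype a] [DecidableEq a] [Fintype o]
    (N : s → o → Matrix a a ℂ) : Prop :=
  ∃ (l : ℕ) (G : Fin l → Matrix a a ℂ) (p : s → Fin l → o → ℝ),
    IsPOVM G ∧ (∀ y i b, 0 ≤ p y i b) ∧ (∀ y i, ∑ b, p y i b = 1) ∧
      ∀ y b, N y b = ∑ i, (p y i b : ℂ) • G i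

/-- A channel is incompatibility breaking if, in the Heisenberg picture, it maps every finite
family of finite-outcome POVMs to a jointly measurable family. -/
def IncompatibilityBreaking {a b : Type*} [Fintype a] [DecidableEq a] [Fintype b] [DecidableEq b]
    (Λ : Matrix a a ℂ →ₗ[ℂ] Matrix b b ℂ) : Prop :=
  ∀ (m n : ℕ) (M : Fin m → Fin n → Matrix b b ℂ), (∀ y, IsPOVM (M y)) →
    JointlyMeasurable fun y i => heisenberg Λ (M y i)

/-- The Schmidt rank of a pure bipartite vector: the rank of its coefficient matrix. -/
noncomputable def schmidtRank {a b : Type*} [Fintype b] (ψ : a × b → ℂ) : ℕ :=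
  (Matrix.of fun i j => ψ (i, j)).rank

/-- The Schmidt number of a bipartite state: the least `k` such that the state is a convex mixture
of pure states (unit vectors) of Schmidt rank at most `k`. -/
noncomputable def schmidtNumber {a b : Type*} [Fintype a] [Fintype b]
    (ρ : Matrix (a × b) (a × b) ℂ) : ℕ :=
  sInf {k | ∃ (n : ℕ) (p : Fin n → ℝ) (ψ : Fin n → a × b → ℂ),
    (∀ i, 0 ≤ p i) ∧ ∑ i, p i = 1 ∧ (∀ i, star (ψ i) ⬝ᵥ ψ i = 1) ∧
      (∀ i, schmidtRank (ψ i) ≤ k) ∧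
      ρ = ∑ i, (p i : ℂ) • Matrix.vecMulVec (ψ i) (star (ψ i))}

/-- `Λ` is `k`-partially entanglement breaking: whatever the reference system and the joint input
state, the output of `id ⊗ Λ` has Schmidt number at most `k`. -/
def PartiallyEntanglementBreaking {a b : Type*} [Fintype a] [Fintype b] (k : ℕ)
    (Λ : Matrix a a ℂ →ₗ[ℂ] Matrix b b ℂ) : Prop :=
  ∀ (r : ℕ) (ρ : Matrix (Fin r × a) (Fin r × a) ℂ), IsDensityMatrix ρ →
    schmidtNumber (idTensor (Fin r) Λ ρ) ≤ k

/-- The partial trace over the second tensor factor. -/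
def partialTraceRight {e f : Type*} [Fintype f] (X : Matrix (e × f) (e × f) ℂ) : Matrix e e ℂ :=
  Matrix.of fun i j => ∑ x, X (i, x) (j, x)

/-- The state of two independent sources, `ρ₁` on `A × B` and `ρ₂` on `C × B'`, with the tensor
factors regrouped as `(A × C) × (B × B')`. -/
def sourcesState {A B B' C : Type*} (ρ₁ : Matrix (A × B) (A × B) ℂ)
    (ρ₂ : Matrix (C × B') (C × B') ℂ) : Matrix ((A × C) × (B × B')) ((A × C) × (B × B')) ℂ :=
  (ρ₁ ⊗ₖ ρ₂).submatrix (fun x => ((x.1.1, x.2.1), (x.1.2, x.2.2)))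
    (fun x => ((x.1.1, x.2.1), (x.1.2, x.2.2)))

/-- The ensemble of subnormalised states prepared at the end points `A`, `C` of a line network
with two sources `ρ₁` (on `A × B`), `ρ₂` (on `C × B'`) and a joint measurement `M` on `B × B'`:
`σ_b = tr_{BB'} ((1_{AC} ⊗ M_b) (ρ₁ ⊗ ρ₂))`. -/
def endpointEnsemble {A B B' C o : Type*} [Fintype A] [DecidableEq A] [Fintype C] [DecidableEq C]
    [Fintype B] [Fintype B'] (ρ₁ : Matrix (A × B) (A × B) ℂ) (ρ₂ : Matrix (C × B') (C × B') ℂ)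
    (M : o → Matrix (B × B') (B × B') ℂ) (i : o) : Matrix (A × C) (A × C) ℂ :=
  partialTraceRight (((1 : Matrix (A × C) (A × C) ℂ) ⊗ₖ M i) * sourcesState ρ₁ ρ₂)

/-- The ensemble `σ` observed at the trusted end points certifies semi-device-independently that
the channels of the network are not `k`-partially entanglement breaking: whatever the
(untrusted, finite-dimensional) systems, source states `ω₁`, `ω₂`, channels `Λ₁`, `Λ₂` and joint
measurement `M` that prepare `σ`, neither of the channels is `k`-partially entanglement breaking. -/
def CertifiesNotPEB {A C o : Type*} [Fintype A] [DecidableEq A] [Fintype C] [DecidableEq C]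
    [Fintype o] (k : ℕ) (σ : o → Matrix (A × C) (A × C) ℂ) : Prop :=
  ∀ (a b c b' : ℕ) (ω₁ : Matrix (A × Fin a) (A × Fin a) ℂ) (ω₂ : Matrix (C × Fin c) (C × Fin c) ℂ)
    (Λ₁ : Matrix (Fin a) (Fin a) ℂ →ₗ[ℂ] Matrix (Fin b) (Fin b) ℂ)
    (Λ₂ : Matrix (Fin c) (Fin c) ℂ →ₗ[ℂ] Matrix (Fin b') (Fin b') ℂ)
    (M : o → Matrix (Fin b × Fin b') (Fin b × Fin b') ℂ),
    IsDensityMatrix ω₁ → IsDensityMatrix ω₂ → IsChannel Λ₁ → IsChannel Λ₂ → IsPOVM M →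
    endpointEnsemble (idTensor A Λ₁ ω₁) (idTensor C Λ₂ ω₂) M = σ →
      ¬ PartiallyEntanglementBreaking k Λ₁ ∧ ¬ PartiallyEntanglementBreaking k Λ₂

/-- The maximally entangled state `|ψ⁺⟩⟨ψ⁺|`, `ψ⁺ = d^{-1/2} ∑ i, |ii⟩`. -/
noncomputable def maxEntangled (d : ℕ) : Matrix (Fin d × Fin d) (Fin d × Fin d) ℂ :=
  Matrix.of fun i j => if i.1 = i.2 ∧ j.1 = j.2 then (d : ℂ)⁻¹ else 0

/-! The channel is nearly noiseless apart from heralded loss: `lossyDepolarizing d u v w` with v ≤ ε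
u, the remaining weight w going to an orthogonal flag |d⟩. Loss makes it incompatibility breaking,
while a certificate that post-selects on a no-loss event does not see the loss.

Incompatibility breaking (`exists_incompatibilityBreaking`): the parent measurement is |z⟩⟨z| dz on
the unit ball of ℂ^d, suitably scaled. For an effect M_b with block A = V†M_bV = ∑ λ_l |b_l⟩⟨b_l|,
the response is R(z) = ∑ λ_l f(|⟨b_l, z⟩|²), with f(s) = s for s ≥ t and 0 otherwise. As f(s) ≤ s,
the responses of a POVM add up to at most ‖z‖² ≤ 1; the missing probability is distributed as the
flag statistics ⟨d|M_b|d⟩. By unitary invariance ∫ R(z)|z⟩⟨z| dz = a tr(A) 1 + (m - a) A, where m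
and a are the moments of f(|z_0|²) along and across its axis. This is the dual of the channel with u
: v = (m - a) : a, and a/(m - a) tends to 0 as t tends to 1 (`exists_threshold_weight`).

Certification: a Bell projection on the two d-dimensional blocks discards the flag, and its outcome
leaves an isotropic state whose noise is of relative order v/u
(`endpointEnsemble_lossyDepolarizing`). A mixture of vectors of Schmidt rank at most k has overlap
at most k/d with the maximally entangled state (`IsSchmidtMixture.sum_diag_le`), and for small ε the
isotropic state exceeds this even for k = d - 1. If either channel of another realisation were
k-partially entanglement breaking, every prepared state would be such a mixture: joint measurements
cannot raise the Schmidt rank supplied by one source (`IsSchmidtMixture.endpointEnsemble_left`,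
`IsSchmidtMixture.endpointEnsemble_right`). -/

/-! ### Spectral decompositions and a trace–rank inequality -/

/-- Entrywise form of the spectral theorem. -/
theorem Matrix.IsHermitian.apply_eq_sum_eigenvalues {n : Type*} [Fintype n] [DecidableEq n]
    {A : Matrix n n ℂ} (hA : A.IsHermitian) (i j : n) :
    A i j = ∑ l, (hA.eigenvalues l : ℂ) *
      (hA.eigenvectorBasis l i * star (hA.eigenvectorBasis l j)) := by
  conv_lhs => rw [hA.spectral_theorem]
  rw [Unitary.conjStarAlgAut_apply, Matrix.mul_apply]
  refine Finset.sum_congr rfl fun l _ => ?_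
  rw [Matrix.mul_diagonal, Matrix.star_apply, Matrix.IsHermitian.eigenvectorUnitary_apply,
    Matrix.IsHermitian.eigenvectorUnitary_apply, Function.comp_apply]
  simp only [Complex.coe_algebraMap]
  ring

/-- A positive semidefinite matrix is a sum of rank-one projections up to normalisation. -/
theorem Matrix.PosSemidef.exists_eq_sum_vecMulVec {n : Type*} [Fintype n]
    {A : Matrix n n ℂ} (hA : A.PosSemidef) :
    ∃ v : n → n → ℂ, A = ∑ l, Matrix.vecMulVec (v l) (star (v l)) := by
  classical
  refine ⟨fun l i => (Real.sqrt (hA.1.eigenvalues l) : ℂ) * hA.1.eigenvectorBasis l i, ?_⟩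
  ext i j
  rw [hA.1.apply_eq_sum_eigenvalues, Matrix.sum_apply]
  refine Finset.sum_congr rfl fun l _ => ?_
  have h : (hA.1.eigenvalues l : ℂ) =
      (Real.sqrt (hA.1.eigenvalues l) : ℂ) * (Real.sqrt (hA.1.eigenvalues l) : ℂ) := by
    rw [← Complex.ofReal_mul, Real.mul_self_sqrt (hA.eigenvalues_nonneg l)]
  rw [h]
  simp [Matrix.vecMulVec_apply]
  ring

/-- The squared modulus of the trace is at most the rank times the squared Frobenius norm. -/
theorem Matrix.norm_trace_sq_le_rank_mul {n : Type*} [Fintype n] (V : Matrix n n ℂ) :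
    ‖V.trace‖ ^ 2 ≤ V.rank * ∑ j, ∑ i, ‖V i j‖ ^ 2 := by
  classical
  -- Expanding the columns of V in an orthonormal basis e of the range writes the trace as a sum
  -- over pairs (column, basis vector). Cauchy–Schwarz then yields the Frobenius norm of V times ∑
  -- ‖e_l‖² = rank V.
  let W : Submodule ℂ (EuclideanSpace ℂ n) := (Matrix.toEuclideanLin V).range
  have hr : Module.finrank ℂ W = V.rank := by
    rw [Matrix.rank_eq_finrank_range_toLin V (PiLp.basisFun 2 ℂ n) (PiLp.basisFun 2 ℂ n),
      ← Matrix.toLpLin_eq_toLin]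
  let e := stdOrthonormalBasis ℂ W
  let v : n → W := fun j => ⟨WithLp.toLp 2 (fun i => V i j), by
    refine ⟨EuclideanSpace.single j 1, ?_⟩
    ext i
    simp [Matrix.toLpLin_apply]⟩
  have hv : ∀ i j, V i j = ∑ l, e.repr (v j) l * (e l : EuclideanSpace ℂ n) i := by
    intro i j
    have h := congrArg (fun w : W => (w : EuclideanSpace ℂ n) i) (e.sum_repr (v j))
    simp only [Submodule.coe_sum, Submodule.coe_smul] at h
    simpa using h.symm
  have hn : ∀ j, ∑ i, ‖V i j‖ ^ 2 = ∑ l, ‖e.repr (v j) l‖ ^ 2 := by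
    intro j
    rw [← EuclideanSpace.norm_sq_eq, LinearIsometryEquiv.norm_map, Submodule.coe_norm,
      EuclideanSpace.norm_sq_eq]
  have he : ∀ l, ∑ j, ‖(e l : EuclideanSpace ℂ n) j‖ ^ 2 = 1 := by
    intro l
    rw [← EuclideanSpace.norm_sq_eq, ← Submodule.coe_norm, e.orthonormal.1 l, one_pow]
  have ht : V.trace = ∑ p : n × Fin (Module.finrank ℂ W),
      e.repr (v p.1) p.2 * (e p.2 : EuclideanSpace ℂ n) p.1 := by
    rw [Fintype.sum_prod_type, Matrix.trace]
    exact Finset.sum_congr rfl fun j _ => hv j j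
  calc ‖V.trace‖ ^ 2
      ≤ (∑ p : n × Fin (Module.finrank ℂ W),
        ‖e.repr (v p.1) p.2‖ * ‖(e p.2 : EuclideanSpace ℂ n) p.1‖) ^ 2 := by
        rw [ht]
        gcongr
        refine (norm_sum_le _ _).trans (le_of_eq ?_)
        simp only [norm_mul]
    _ ≤ (∑ p : n × Fin (Module.finrank ℂ W), ‖e.repr (v p.1) p.2‖ ^ 2) *
        ∑ p : n × Fin (Module.finrank ℂ W), ‖(e p.2 : EuclideanSpace ℂ n) p.1‖ ^ 2 :=
        Finset.sum_mul_sq_le_sq_mul_sq _ _ _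
    _ = V.rank * ∑ j, ∑ i, ‖V i j‖ ^ 2 := by
        rw [Fintype.sum_prod_type, Fintype.sum_prod_type_right]
        simp only [he, hn, Finset.sum_const, Finset.card_univ, Fintype.card_fin, hr, nsmul_eq_mul,
          mul_one]
        ring

/-! ### Mixtures of vectors of bounded Schmidt rank -/

/-- An unnormalised bipartite state which is a sum of projections, up to normalisation, on vectors
of Schmidt rank at most `k`. -/
def IsSchmidtMixture {a b : Type*} [Fintype b] (k : ℕ) (σ : Matrix (a × b) (a × b) ℂ) : Prop :=
  ∃ (ι : Type) (_ : Fintype ι) (v : ι → a × b → ℂ), (∀ i, schmidtRank (v i) ≤ k) ∧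
    σ = ∑ i, Matrix.vecMulVec (v i) (star (v i))

theorem schmidtRank_smul_le {a b : Type*} [Fintype b] [Fintype a] (c : ℂ) (ψ : a × b → ℂ) :
    schmidtRank (c • ψ) ≤ schmidtRank ψ := by
  classical
  have h : (Matrix.of fun i j => (c • ψ) (i, j)) =
      (c • (1 : Matrix a a ℂ)) * Matrix.of fun i j => ψ (i, j) := by
    ext i j
    simp
  unfold schmidtRank
  rw [h]
  exact Matrix.rank_mul_le_right _ _

/-- Overlap with the maximally entangled state of a mixture of vectors of bounded Schmidt rank. -/
theorem IsSchmidtMixture.sum_diag_le {n : Type*} [Fintype n] {k : ℕ}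
    {σ : Matrix (n × n) (n × n) ℂ} (h : IsSchmidtMixture k σ) :
    (∑ i, ∑ j, σ (i, i) (j, j)).re ≤ k * σ.trace.re := by
  obtain ⟨ι, _, v, hv, rfl⟩ := h
  -- For a vector with coefficient matrix V, the unnormalised overlap is |tr V|² and the trace is
  -- the squared Frobenius norm, so the trace–rank inequality applies term by term.
  have h1 : ∑ i, ∑ j, (∑ l, Matrix.vecMulVec (v l) (star (v l))) (i, i) (j, j) =
      ∑ l, (((‖(Matrix.of fun i j => v l (i, j)).trace‖ ^ 2 : ℝ)) : ℂ) := by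
    simp only [Matrix.sum_apply, Matrix.vecMulVec_apply, Pi.star_apply]
    rw [show (∑ i, ∑ j, ∑ l, v l (i, i) * star (v l (j, j))) =
      ∑ l, ∑ i, ∑ j, v l (i, i) * star (v l (j, j)) by
        rw [Finset.sum_comm (s := (Finset.univ : Finset ι))]
        exact Finset.sum_congr rfl fun i _ => Finset.sum_comm]
    refine Finset.sum_congr rfl fun l _ => ?_
    rw [Complex.ofReal_pow, ← Complex.mul_conj', Matrix.trace, map_sum, Finset.sum_mul_sum]
    rfl
  have h2 : (∑ l, Matrix.vecMulVec (v l) (star (v l))).trace =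
      ∑ l, ((∑ j, ∑ i, ‖(Matrix.of fun i j => v l (i, j)) i j‖ ^ 2 : ℝ) : ℂ) := by
    rw [Matrix.trace_sum]
    refine Finset.sum_congr rfl fun l _ => ?_
    rw [Matrix.trace, Fintype.sum_prod_type_right]
    push_cast
    refine Finset.sum_congr rfl fun j _ => Finset.sum_congr rfl fun i _ => ?_
    rw [← Complex.mul_conj']
    rfl
  rw [h1, h2, ← Complex.ofReal_sum, ← Complex.ofReal_sum, Complex.ofReal_re, Complex.ofReal_re,
    Finset.mul_sum]
  refine Finset.sum_le_sum fun l _ => (Matrix.norm_trace_sq_le_rank_mul _).trans ?_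
  gcongr
  exact hv l

/-- The set in `schmidtNumber` is nonempty for a density matrix, by the eigendecomposition.
Otherwise `sInf ∅ = 0` would make an upper bound on the Schmidt number say nothing. -/
theorem exists_schmidt_decomposition {a b : Type*} [Fintype a] [Fintype b]
    {ρ : Matrix (a × b) (a × b) ℂ} (hρ : IsDensityMatrix ρ) :
    ∃ k, ∃ (n : ℕ) (p : Fin n → ℝ) (ψ : Fin n → a × b → ℂ),
      (∀ i, 0 ≤ p i) ∧ ∑ i, p i = 1 ∧ (∀ i, star (ψ i) ⬝ᵥ ψ i = 1) ∧
        (∀ i, schmidtRank (ψ i) ≤ k) ∧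
        ρ = ∑ i, (p i : ℂ) • Matrix.vecMulVec (ψ i) (star (ψ i)) := by
  classical
  have hH := hρ.1.1
  let e := Fintype.equivFin (a × b)
  refine ⟨Fintype.card b, Fintype.card (a × b), fun l => hH.eigenvalues (e.symm l),
    fun l => (hH.eigenvectorBasis (e.symm l)).ofLp, fun l => hρ.1.eigenvalues_nonneg _,
    ?_, fun l => ?_, fun l => Matrix.rank_le_card_width _, ?_⟩
  · rw [e.symm.sum_comp (fun l => hH.eigenvalues l)]
    have h := hH.trace_eq_sum_eigenvalues
    rw [hρ.2] at h
    exact Complex.ofReal_injective (by rw [Complex.ofReal_sum]; exact h.symm)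
  · have h := hH.eigenvectorBasis.orthonormal.1 (e.symm l)
    have h2 : inner ℂ (hH.eigenvectorBasis (e.symm l)) (hH.eigenvectorBasis (e.symm l)) = (1 : ℂ) := by
      rw [inner_self_eq_norm_sq_to_K, h]; simp
    rw [EuclideanSpace.inner_eq_star_dotProduct, dotProduct_comm] at h2
    exact h2
  · rw [e.symm.sum_comp (fun l => (hH.eigenvalues l : ℂ) •
      Matrix.vecMulVec (hH.eigenvectorBasis l).ofLp (star (hH.eigenvectorBasis l).ofLp))]
    ext i j
    rw [hH.apply_eq_sum_eigenvalues, Matrix.sum_apply]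
    simp [Matrix.vecMulVec_apply]

theorem IsSchmidtMixture.of_schmidtNumber_le {a b : Type*} [Fintype a] [Fintype b] {k : ℕ}
    {ρ : Matrix (a × b) (a × b) ℂ} (hρ : IsDensityMatrix ρ) (hk : schmidtNumber ρ ≤ k) :
    IsSchmidtMixture k ρ := by
  obtain ⟨n, p, ψ, hp, -, -, hψ, h⟩ := Nat.sInf_mem (exists_schmidt_decomposition hρ)
  refine ⟨Fin n, inferInstance, fun i => (Real.sqrt (p i) : ℂ) • ψ i,
    fun i => (schmidtRank_smul_le _ _).trans ((hψ i).trans hk), ?_⟩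
  rw [h]
  refine Finset.sum_congr rfl fun i _ => ?_
  ext x y
  have h : (p i : ℂ) = (Real.sqrt (p i) : ℂ) * (Real.sqrt (p i) : ℂ) := by
    rw [← Complex.ofReal_mul, Real.mul_self_sqrt (hp i)]
  rw [Matrix.smul_apply, h]
  simp [Matrix.vecMulVec_apply]
  ring

/-! ### Propagation of the Schmidt rank through the line network -/

theorem endpointEnsemble_apply {A B B' C o : Type*} [Fintype A] [DecidableEq A] [Fintype C]
    [DecidableEq C] [Fintype B] [Fintype B'] (ρ₁ : Matrix (A × B) (A × B) ℂ)
    (ρ₂ : Matrix (C × B') (C × B') ℂ) (M : o → Matrix (B × B') (B × B') ℂ) (i : o)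
    (x y : A × C) :
    endpointEnsemble ρ₁ ρ₂ M i x y = ∑ s : B × B', ∑ t : B × B',
      M i s t * (ρ₁ (x.1, t.1) (y.1, s.1) * ρ₂ (x.2, t.2) (y.2, s.2)) := by
  simp only [endpointEnsemble, partialTraceRight, Matrix.of_apply, Matrix.mul_apply]
  refine Finset.sum_congr rfl fun s _ => ?_
  rw [Fintype.sum_prod_type]
  simp [Matrix.kroneckerMap_apply, Matrix.one_apply, sourcesState]

/-- Projecting ψ ⊗ φ on a vector m of B ⊗ B' leaves a pure vector on A ⊗ C; everything else is
bilinearity. -/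
theorem endpointEnsemble_eq_sum_vecMulVec {A B B' C o ι κ μ : Type*} [Fintype A] [DecidableEq A]
    [Fintype C] [DecidableEq C] [Fintype B] [Fintype B'] [Fintype ι] [Fintype κ] [Fintype μ]
    (ψ : ι → A × B → ℂ) (φ : κ → C × B' → ℂ) (m : μ → B × B' → ℂ)
    (M : o → Matrix (B × B') (B × B') ℂ) (i : o)
    (hM : M i = ∑ l, Matrix.vecMulVec (m l) (star (m l))) :
    endpointEnsemble (∑ l, Matrix.vecMulVec (ψ l) (star (ψ l)))
      (∑ l, Matrix.vecMulVec (φ l) (star (φ l))) M i =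
      ∑ q : ι × κ × μ, Matrix.vecMulVec
        (fun x => ∑ t : B × B', star (m q.2.2 t) * (ψ q.1 (x.1, t.1) * φ q.2.1 (x.2, t.2)))
        (star fun x =>
          ∑ t : B × B', star (m q.2.2 t) * (ψ q.1 (x.1, t.1) * φ q.2.1 (x.2, t.2))) := by
  ext x y
  rw [endpointEnsemble_apply, hM, Matrix.sum_apply]
  simp only [Matrix.sum_apply, Matrix.vecMulVec_apply, Pi.star_apply, star_sum, star_mul',
    star_star]
  have h : ∀ s t : B × B',
      (∑ l, m l s * star (m l t)) * ((∑ l, ψ l (x.1, t.1) * star (ψ l (y.1, s.1))) *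
        ∑ l, φ l (x.2, t.2) * star (φ l (y.2, s.2))) =
      ∑ q : ι × κ × μ, star (m q.2.2 t) * (ψ q.1 (x.1, t.1) * φ q.2.1 (x.2, t.2)) *
        (m q.2.2 s * (star (ψ q.1 (y.1, s.1)) * star (φ q.2.1 (y.2, s.2)))) := by
    intro s t
    simp only [Fintype.sum_prod_type]
    rw [mul_comm, Finset.sum_mul_sum, Finset.sum_mul]
    refine Finset.sum_congr rfl fun _ _ => ?_
    rw [Finset.sum_mul]
    refine Finset.sum_congr rfl fun _ _ => ?_
    rw [Finset.mul_sum]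
    exact Finset.sum_congr rfl fun _ _ => by ring
  simp only [h]
  simp only [Finset.sum_mul_sum]
  rw [Finset.sum_comm]
  rw [Finset.sum_comm (s := (Finset.univ : Finset (ι × κ × μ)))]
  refine Finset.sum_congr rfl fun t _ => ?_
  rw [Finset.sum_comm]

/-- The coefficient matrix of each resulting A–C vector factors through that of ψ, so its rank is at
most the Schmidt rank of ψ. -/
theorem IsSchmidtMixture.endpointEnsemble_left {A B B' C o : Type} [Fintype A] [DecidableEq A]
    [Fintype C] [DecidableEq C] [Fintype B] [Fintype B'] {k : ℕ} {ρ₁ : Matrix (A × B) (A × B) ℂ}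
    {ρ₂ : Matrix (C × B') (C × B') ℂ} {M : o → Matrix (B × B') (B × B') ℂ} {i : o}
    (h₁ : IsSchmidtMixture k ρ₁) (h₂ : ρ₂.PosSemidef) (hM : (M i).PosSemidef) :
    IsSchmidtMixture k (endpointEnsemble ρ₁ ρ₂ M i) := by
  obtain ⟨ι, _, ψ, hψ, rfl⟩ := h₁
  obtain ⟨φ, rfl⟩ := h₂.exists_eq_sum_vecMulVec
  obtain ⟨m, hm⟩ := hM.exists_eq_sum_vecMulVec
  refine ⟨_, inferInstance, _, fun q => ?_, endpointEnsemble_eq_sum_vecMulVec ψ φ m M i hm⟩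
  refine le_trans ?_ (hψ q.1)
  have h : (Matrix.of fun (x : A) (y : C) => ∑ t : B × B', star (m q.2.2 t) *
      (ψ q.1 (x, t.1) * φ q.2.1 (y, t.2))) = (Matrix.of fun x b => ψ q.1 (x, b)) *
      Matrix.of fun b y => ∑ b', star (m q.2.2 (b, b')) * φ q.2.1 (y, b') := by
    ext x y
    simp only [Matrix.of_apply, Matrix.mul_apply, Fintype.sum_prod_type, Finset.mul_sum]
    refine Finset.sum_congr rfl fun _ _ => Finset.sum_congr rfl fun _ _ => by ring
  unfold schmidtRank
  rw [h]
  exact Matrix.rank_mul_le_left _ _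

theorem IsSchmidtMixture.endpointEnsemble_right {A B B' C o : Type} [Fintype A] [DecidableEq A]
    [Fintype C] [DecidableEq C] [Fintype B] [Fintype B'] {k : ℕ} {ρ₁ : Matrix (A × B) (A × B) ℂ}
    {ρ₂ : Matrix (C × B') (C × B') ℂ} {M : o → Matrix (B × B') (B × B') ℂ} {i : o}
    (h₁ : ρ₁.PosSemidef) (h₂ : IsSchmidtMixture k ρ₂) (hM : (M i).PosSemidef) :
    IsSchmidtMixture k (endpointEnsemble ρ₁ ρ₂ M i) := by
  obtain ⟨ψ, rfl⟩ := h₁.exists_eq_sum_vecMulVec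
  obtain ⟨ι, _, φ, hφ, rfl⟩ := h₂
  obtain ⟨m, hm⟩ := hM.exists_eq_sum_vecMulVec
  refine ⟨_, inferInstance, _, fun q => ?_, endpointEnsemble_eq_sum_vecMulVec ψ φ m M i hm⟩
  refine le_trans ?_ (hφ q.2.1)
  have h : (Matrix.of fun (x : A) (y : C) => ∑ t : B × B', star (m q.2.2 t) *
      (ψ q.1 (x, t.1) * φ q.2.1 (y, t.2))) =
      (Matrix.of fun x b' => ∑ b, star (m q.2.2 (b, b')) * ψ q.1 (x, b)) *
      (Matrix.of fun y b' => φ q.2.1 (y, b')).transpose := by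
    ext x y
    simp only [Matrix.of_apply, Matrix.mul_apply, Fintype.sum_prod_type_right, Finset.sum_mul,
      Matrix.transpose_apply]
    refine Finset.sum_congr rfl fun _ _ => Finset.sum_congr rfl fun _ _ => by ring
  unfold schmidtRank
  rw [h]
  exact (Matrix.rank_mul_le_right _ _).trans (Matrix.rank_transpose _).le

/-! ### The lossy depolarizing channel -/

/-- The isometric embedding of `ℂ^d` into `ℂ^(d+1)`. -/
def embedMatrix (d : ℕ) : Matrix (Fin (d + 1)) (Fin d) ℂ :=
  Matrix.of fun x i => if x = i.castSucc then 1 else 0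

/-- The channel `X ↦ u V X V† + tr X (v V V† + w |d⟩⟨d|)`: depolarisation followed by erasure. -/
noncomputable def lossyDepolarizing (d : ℕ) (u v w : ℝ) :
    Matrix (Fin d) (Fin d) ℂ →ₗ[ℂ] Matrix (Fin (d + 1)) (Fin (d + 1)) ℂ where
  toFun X := (u : ℂ) • (embedMatrix d * X * (embedMatrix d).conjTranspose) +
    X.trace • ((v : ℂ) • (embedMatrix d * (embedMatrix d).conjTranspose) +
      (w : ℂ) • Matrix.single (Fin.last d) (Fin.last d) 1)
  map_add' X Y := by
    simp only [Matrix.mul_add, Matrix.add_mul, Matrix.trace_add, smul_add, add_smul]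
    abel
  map_smul' c X := by
    simp only [Matrix.mul_smul, Matrix.smul_mul, Matrix.trace_smul, RingHom.id_apply, smul_add,
      smul_smul, smul_eq_mul, mul_comm, mul_left_comm]

theorem lossyDepolarizing_apply (d : ℕ) (u v w : ℝ) (X : Matrix (Fin d) (Fin d) ℂ) :
    lossyDepolarizing d u v w X =
      (u : ℂ) • (embedMatrix d * X * (embedMatrix d).conjTranspose) +
        X.trace • ((v : ℂ) • (embedMatrix d * (embedMatrix d).conjTranspose) +
          (w : ℂ) • Matrix.single (Fin.last d) (Fin.last d) 1) := rfl

theorem embedMatrix_conjTranspose_mul_self (d : ℕ) :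
    (embedMatrix d).conjTranspose * embedMatrix d = 1 := by
  ext i j
  simp [embedMatrix, Matrix.mul_apply, Matrix.one_apply, eq_comm]

theorem embedMatrix_mul_mul_apply_castSucc (d : ℕ) (X : Matrix (Fin d) (Fin d) ℂ) (i j : Fin d) :
    (embedMatrix d * X * (embedMatrix d).conjTranspose) i.castSucc j.castSucc = X i j := by
  simp [embedMatrix, Matrix.mul_apply]

theorem trace_lossyDepolarizing {d : ℕ} {u v w : ℝ} (h : u + d * v + w = 1)
    (X : Matrix (Fin d) (Fin d) ℂ) : (lossyDepolarizing d u v w X).trace = X.trace := by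
  have h' : (u : ℂ) + d * v + w = 1 := by exact_mod_cast h
  rw [lossyDepolarizing_apply, Matrix.trace_add, Matrix.trace_smul, Matrix.trace_smul,
    Matrix.trace_add, Matrix.trace_smul, Matrix.trace_smul, Matrix.trace_mul_cycle,
    embedMatrix_conjTranspose_mul_self, Matrix.one_mul, Matrix.trace_mul_comm,
    embedMatrix_conjTranspose_mul_self, Matrix.trace_one, Matrix.trace_single_eq_same,
    Fintype.card_fin]
  simp only [smul_eq_mul]
  linear_combination X.trace * h'

theorem posSemidef_partialTraceRight {e f : Type*} [Fintype e] [Fintype f]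
    {X : Matrix (e × f) (e × f) ℂ} (hX : X.PosSemidef) : (partialTraceRight X).PosSemidef := by
  have h : partialTraceRight X = ∑ x, X.submatrix (fun i => (i, x)) (fun i => (i, x)) := by
    ext i j
    simp [partialTraceRight, Matrix.sum_apply]
  rw [h]
  exact Matrix.posSemidef_sum _ fun x _ => hX.submatrix _

/-- Complete positivity is visible from this form: a congruence plus a Kronecker product of positive
semidefinite matrices. -/
theorem idTensor_lossyDepolarizing (d : ℕ) (u v w : ℝ) {r : Type*} [Fintype r] [DecidableEq r]
    (X : Matrix (r × Fin d) (r × Fin d) ℂ) :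
    idTensor r (lossyDepolarizing d u v w) X =
      (u : ℂ) • (((1 : Matrix r r ℂ) ⊗ₖ embedMatrix d) * X *
        ((1 : Matrix r r ℂ) ⊗ₖ embedMatrix d).conjTranspose) +
      partialTraceRight X ⊗ₖ ((v : ℂ) • (embedMatrix d * (embedMatrix d).conjTranspose) +
          (w : ℂ) • Matrix.single (Fin.last d) (Fin.last d) 1) := by
  ext ⟨i, x⟩ ⟨j, y⟩
  rw [idTensor, Matrix.of_apply, lossyDepolarizing_apply, Matrix.add_apply, Matrix.add_apply]
  congr 1
  rw [Matrix.smul_apply, Matrix.smul_apply]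
  congr 1
  have h : ∀ q : r × Fin d, (((1 : Matrix r r ℂ) ⊗ₖ embedMatrix d) * X) (i, x) q =
      ∑ t, embedMatrix d x t * X (i, t) q := fun q => by
    rw [Matrix.mul_apply, Fintype.sum_prod_type, Finset.sum_eq_single i]
    · simp [Matrix.kroneckerMap_apply]
    · intro i' _ hi'
      simp [Matrix.kroneckerMap_apply, hi'.symm]
    · simp
  rw [Matrix.mul_apply, Matrix.mul_apply, Fintype.sum_prod_type, Finset.sum_eq_single j]
  · refine Finset.sum_congr rfl fun t _ => ?_
    rw [h, Matrix.mul_apply]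
    simp [Matrix.kroneckerMap_apply, Matrix.conjTranspose_apply]
  · intro j' _ hj'
    simp [Matrix.kroneckerMap_apply, Matrix.conjTranspose_apply, hj'.symm]
  · simp

theorem isChannel_lossyDepolarizing {d : ℕ} {u v w : ℝ} (hu : 0 ≤ u) (hv : 0 ≤ v) (hw : 0 ≤ w)
    (h : u + d * v + w = 1) : IsChannel (lossyDepolarizing d u v w) := by
  refine ⟨fun n X hX => ?_, trace_lossyDepolarizing h⟩
  rw [idTensor_lossyDepolarizing]
  have hc : ∀ {r : ℝ}, 0 ≤ r → (0 : ℂ) ≤ (r : ℂ) := fun hr => by exact_mod_cast hr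
  have hs : (Matrix.single (Fin.last d) (Fin.last d) (1 : ℂ)).PosSemidef := by
    have := Matrix.posSemidef_vecMulVec_self_star (Pi.single (Fin.last d) (1 : ℂ))
    rwa [← Pi.single_star, star_one, ← Matrix.single_eq_single_vecMulVec_single] at this
  exact ((hX.mul_mul_conjTranspose_same _).smul (hc hu)).add
    ((posSemidef_partialTraceRight hX).kronecker
      (((Matrix.posSemidef_self_mul_conjTranspose _).smul (hc hv)).add (hs.smul (hc hw))))

theorem heisenberg_lossyDepolarizing (d : ℕ) (u v w : ℝ)
    (E : Matrix (Fin (d + 1)) (Fin (d + 1)) ℂ) (i j : Fin d) :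
    heisenberg (lossyDepolarizing d u v w) E i j =
      u * ((embedMatrix d).conjTranspose * E * embedMatrix d) i j +
        if i = j then (v * ((embedMatrix d).conjTranspose * E * embedMatrix d).trace +
          w * E (Fin.last d) (Fin.last d)) else 0 := by
  have h : ∀ X : Matrix (Fin d) (Fin d) ℂ,
      (E * (embedMatrix d * X * (embedMatrix d).conjTranspose)).trace =
      ((embedMatrix d).conjTranspose * E * embedMatrix d * X).trace := fun X => by
    rw [← Matrix.mul_assoc, Matrix.trace_mul_comm]
    simp only [Matrix.mul_assoc]
  have h1 := h 1
  rw [Matrix.mul_one, Matrix.mul_one] at h1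
  rw [heisenberg, Matrix.of_apply, lossyDepolarizing_apply, Matrix.mul_add, Matrix.mul_smul,
    Matrix.mul_smul, Matrix.mul_add, Matrix.mul_smul, Matrix.mul_smul, Matrix.trace_add,
    Matrix.trace_smul, Matrix.trace_smul, Matrix.trace_add, Matrix.trace_smul, Matrix.trace_smul,
    h, h1, Matrix.trace_mul_single, Matrix.trace_mul_single]
  by_cases hij : i = j
  · subst hij
    simp [Matrix.trace_single_eq_same]
  · simp [hij, Matrix.trace_single_eq_of_ne j i (1 : ℂ) (Ne.symm hij)]

/-! ### Unitarily invariant second moments of the ball -/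

open MeasureTheory in
/-- Lebesgue measure restricted to the unit ball of `ℂ^n`. -/
noncomputable def ballMeasure (n : Type*) [Fintype n] : Measure (EuclideanSpace ℂ n) :=
  volume.restrict (Metric.closedBall 0 1)

instance (n : Type*) [Fintype n] : MeasureTheory.IsFiniteMeasure (ballMeasure n) :=
  ⟨by rw [ballMeasure, MeasureTheory.Measure.restrict_apply_univ]
      exact MeasureTheory.measure_closedBall_lt_top⟩

theorem ae_ballMeasure_norm_le_one (n : Type*) [Fintype n] : ∀ᵐ z ∂ballMeasure n, ‖z‖ ≤ 1 := by
  filter_upwards [MeasureTheory.ae_restrict_mem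
    (Metric.isClosed_closedBall (x := (0 : EuclideanSpace ℂ n)) (ε := 1)).measurableSet] with z hz
  simpa using hz

/-- A complex unitary is a real linear isometry, hence preserves both volume and the ball. -/
theorem integral_ballMeasure_comp {n : Type*} [Fintype n]
    (U : EuclideanSpace ℂ n ≃ₗᵢ[ℂ] EuclideanSpace ℂ n) {G : Type*} [NormedAddCommGroup G]
    [NormedSpace ℝ G] (F : EuclideanSpace ℂ n → G) :
    ∫ z, F (U z) ∂ballMeasure n = ∫ z, F z ∂ballMeasure n := by
  let U' : EuclideanSpace ℂ n ≃ₗᵢ[ℝ] EuclideanSpace ℂ n :=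
    ⟨U.toLinearEquiv.restrictScalars ℝ, U.norm_map⟩
  have h := U'.measurePreserving.setIntegral_preimage_emb
    U'.toMeasurableEquiv.measurableEmbedding F (Metric.closedBall 0 1)
  have h' : (U' : EuclideanSpace ℂ n → EuclideanSpace ℂ n) ⁻¹' Metric.closedBall 0 1 =
      Metric.closedBall 0 1 := by
    ext z
    simp
  rw [h'] at h
  exact h

theorem integrable_ballMeasure {n : Type*} [Fintype n] {G : Type*} [NormedAddCommGroup G]
    {F : EuclideanSpace ℂ n → G}
    (hF : MeasureTheory.AEStronglyMeasurable F (ballMeasure n)) (C : ℝ)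
    (hC : ∀ z, ‖z‖ ≤ 1 → ‖F z‖ ≤ C) : MeasureTheory.Integrable F (ballMeasure n) :=
  MeasureTheory.Integrable.of_bound hF C
    (by filter_upwards [ae_ballMeasure_norm_le_one n] with z hz using hC z hz)

theorem norm_inner_sq_le_one {E : Type*} [NormedAddCommGroup E] [InnerProductSpace ℂ E] {x z : E}
    (hx : ‖x‖ = 1) (hz : ‖z‖ ≤ 1) : ‖(inner ℂ x z : ℂ)‖ ^ 2 ≤ 1 := by
  have h := norm_inner_le_norm (𝕜 := ℂ) x z
  rw [hx, one_mul] at h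
  exact pow_le_one₀ (norm_nonneg _) (h.trans hz)

theorem EuclideanSpace.norm_apply_le {n : Type*} [Fintype n] (z : EuclideanSpace ℂ n) (i : n) :
    ‖z i‖ ≤ ‖z‖ := PiLp.norm_apply_le z i

theorem exists_perm_apply_eq {n : Type*} [DecidableEq n] {l k i j : n} (hlk : l ≠ k)
    (hij : i ≠ j) : ∃ e : Equiv.Perm n, e l = i ∧ e k = j := by
  have h : i ≠ Equiv.swap l i k := fun h => by
    rw [eq_comm, Equiv.swap_apply_eq_iff, Equiv.swap_apply_right] at h
    exact hlk h.symm
  refine ⟨(Equiv.swap l i).trans (Equiv.swap (Equiv.swap l i k) j), ?_, ?_⟩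
  · rw [Equiv.trans_apply, Equiv.swap_apply_left, Equiv.swap_apply_of_ne_of_ne h hij]
  · rw [Equiv.trans_apply, Equiv.swap_apply_left]

section Moments

variable {n : Type*} [Fintype n] [DecidableEq n] (f : ℝ → ℝ)

/-- The coordinate moments of an axially symmetric weight on the unit ball. -/
theorem integral_coord_eq {i₀ i₁ : n} (h₀₁ : i₀ ≠ i₁) (l k j : n) :
    ∫ z, (f (‖z l‖ ^ 2) : ℂ) * (z k * star (z j)) ∂ballMeasure n =
      if k = j then (if k = l then ((∫ z, f (‖z i₀‖ ^ 2) * ‖z i₀‖ ^ 2 ∂ballMeasure n : ℝ) : ℂ)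
        else ((∫ z, f (‖z i₀‖ ^ 2) * ‖z i₁‖ ^ 2 ∂ballMeasure n : ℝ) : ℂ)) else 0 := by
  split_ifs with hkj hkl
  · subst hkj hkl
    rw [← integral_ballMeasure_comp
      (LinearIsometryEquiv.piLpCongrLeft 2 ℂ ℂ (Equiv.swap i₀ k)), ← integral_complex_ofReal]
    refine MeasureTheory.integral_congr_ae (Filter.Eventually.of_forall fun z => ?_)
    simp only [LinearIsometryEquiv.piLpCongrLeft_apply, Equiv.piCongrLeft'_apply,
      Equiv.symm_swap, Equiv.swap_apply_right]
    push_cast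
    rw [← Complex.mul_conj']
    rfl
  · subst hkj
    obtain ⟨e, he₀, he₁⟩ := exists_perm_apply_eq (Ne.symm hkl) h₀₁
    rw [← integral_ballMeasure_comp
      (LinearIsometryEquiv.piLpCongrLeft 2 ℂ ℂ e.symm), ← integral_complex_ofReal]
    refine MeasureTheory.integral_congr_ae (Filter.Eventually.of_forall fun z => ?_)
    simp only [LinearIsometryEquiv.piLpCongrLeft_apply, Equiv.piCongrLeft'_apply,
      Equiv.symm_symm, he₀, he₁]
    push_cast
    rw [← Complex.mul_conj']
    rfl
  -- Flipping the sign of z_k preserves the weight and negates z_k z̄_j for j ≠ k, so the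
  -- off-diagonal moment vanishes.
  · let U : EuclideanSpace ℂ n ≃ₗᵢ[ℂ] EuclideanSpace ℂ n :=
      LinearIsometryEquiv.piLpCongrRight 2 fun i =>
        if i = k then LinearIsometryEquiv.neg ℂ else LinearIsometryEquiv.refl ℂ ℂ
    have hU : ∀ z i, U z i = if i = k then -z i else z i := by
      intro z i
      simp only [U, LinearIsometryEquiv.piLpCongrRight_apply]
      split_ifs <;> simp
    have h := integral_ballMeasure_comp U
      (fun z => (f (‖z l‖ ^ 2) : ℂ) * (z k * star (z j)))
    have h2 : ∀ z, (f (‖U z l‖ ^ 2) : ℂ) * (U z k * star (U z j)) =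
        -((f (‖z l‖ ^ 2) : ℂ) * (z k * star (z j))) := by
      intro z
      rw [hU, hU, hU, if_pos rfl, if_neg (Ne.symm hkj)]
      split_ifs <;> simp
    simp only [h2] at h
    rw [MeasureTheory.integral_neg] at h
    exact self_eq_neg.mp h.symm

/-- Twirling: the matrix moments of an axially symmetric weight. -/
theorem integral_inner_eq (hf : Measurable f) (hb : ∀ s, 0 ≤ s → s ≤ 1 → |f s| ≤ 1)
    {i₀ i₁ : n} (h₀₁ : i₀ ≠ i₁) (b : OrthonormalBasis n ℂ (EuclideanSpace ℂ n)) (l i j : n) :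
    ∫ z, (f (‖(inner ℂ (b l) z : ℂ)‖ ^ 2) : ℂ) * (z i * star (z j)) ∂ballMeasure n =
      (if i = j then ((∫ z, f (‖z i₀‖ ^ 2) * ‖z i₁‖ ^ 2 ∂ballMeasure n : ℝ) : ℂ) else 0) +
      ((∫ z, f (‖z i₀‖ ^ 2) * ‖z i₀‖ ^ 2 ∂ballMeasure n : ℝ) -
        (∫ z, f (‖z i₀‖ ^ 2) * ‖z i₁‖ ^ 2 ∂ballMeasure n : ℝ) : ℂ) *
        (b l i * star (b l j)) := by
  have hz : ∀ (z : EuclideanSpace ℂ n) i, z i = ∑ k, b.repr z k * b k i := by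
    intro z i
    have h := congrArg (fun w : EuclideanSpace ℂ n => w i) (b.sum_repr z)
    simpa using h.symm
  have hδ : ∑ k, b k i * star (b k j) = if i = j then 1 else 0 := by
    have h := hz (EuclideanSpace.single j 1) i
    simp only [b.repr_apply_apply, EuclideanSpace.inner_single_right] at h
    simp only [PiLp.single_apply, one_mul] at h
    rw [h]
    exact Finset.sum_congr rfl fun k _ => mul_comm _ _
  have hint : ∀ k k', MeasureTheory.Integrable (fun z : EuclideanSpace ℂ n =>
      (f (‖z l‖ ^ 2) : ℂ) * (z k * star (z k'))) (ballMeasure n) := by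
    intro k k'
    refine integrable_ballMeasure (Measurable.aestronglyMeasurable ?_) 1 fun z hz => ?_
    · have : Measurable fun z : EuclideanSpace ℂ n => f (‖z l‖ ^ 2) := hf.comp (by fun_prop)
      have h2 : ∀ k, Measurable fun z : EuclideanSpace ℂ n => z k := fun k => by fun_prop
      exact (Complex.measurable_ofReal.comp this).mul ((h2 k).mul (continuous_star.measurable.comp (h2 k')))
    · have h := fun i => (EuclideanSpace.norm_apply_le z i).trans hz
      rw [norm_mul, norm_mul, norm_star, Complex.norm_real, Real.norm_eq_abs]
      exact mul_le_one₀ (hb _ (sq_nonneg _) (pow_le_one₀ (norm_nonneg _) (h l)))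
        (by positivity) (mul_le_one₀ (h k) (norm_nonneg _) (h k'))
  calc ∫ z, (f (‖(inner ℂ (b l) z : ℂ)‖ ^ 2) : ℂ) * (z i * star (z j)) ∂ballMeasure n
      = ∫ z, (∑ k, ∑ k', (f (‖b.repr z l‖ ^ 2) : ℂ) * (b.repr z k * star (b.repr z k')) *
          (b k i * star (b k' j))) ∂ballMeasure n := by
        refine MeasureTheory.integral_congr_ae (Filter.Eventually.of_forall fun z => ?_)
        simp only [← b.repr_apply_apply]
        rw [hz z i, hz z j, star_sum, Finset.sum_mul_sum, Finset.mul_sum]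
        refine Finset.sum_congr rfl fun k _ => ?_
        rw [Finset.mul_sum]
        refine Finset.sum_congr rfl fun k' _ => ?_
        rw [star_mul']
        ring
    -- The unitary `b.repr` turns the axis b_l into the l-th coordinate axis, which reduces the
    -- claim to `integral_coord_eq`.
    _ = ∫ z, (∑ k, ∑ k', (f (‖z l‖ ^ 2) : ℂ) * (z k * star (z k')) *
          (b k i * star (b k' j))) ∂ballMeasure n :=
        integral_ballMeasure_comp b.repr (fun z => ∑ k, ∑ k', (f (‖z l‖ ^ 2) : ℂ) *
          (z k * star (z k')) * (b k i * star (b k' j)))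
    _ = ∑ k, ∑ k', (∫ z, (f (‖z l‖ ^ 2) : ℂ) * (z k * star (z k')) ∂ballMeasure n) *
          (b k i * star (b k' j)) := by
        rw [MeasureTheory.integral_finsetSum _ fun k _ =>
          MeasureTheory.integrable_finsetSum _ fun k' _ => (hint k k').mul_const _]
        refine Finset.sum_congr rfl fun k _ => ?_
        rw [MeasureTheory.integral_finsetSum _ fun k' _ => (hint k k').mul_const _]
        exact Finset.sum_congr rfl fun k' _ => MeasureTheory.integral_mul_const _ _
    _ = _ := by
        simp only [integral_coord_eq f h₀₁, ite_mul, zero_mul, Finset.sum_ite_eq, Finset.mem_univ,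
          if_true]
        set m : ℂ := ((∫ z, f (‖z i₀‖ ^ 2) * ‖z i₀‖ ^ 2 ∂ballMeasure n : ℝ) : ℂ)
        set a : ℂ := ((∫ z, f (‖z i₀‖ ^ 2) * ‖z i₁‖ ^ 2 ∂ballMeasure n : ℝ) : ℂ)
        have h : ∀ k, (if k = l then m * (b k i * star (b k j)) else a * (b k i * star (b k j))) =
            a * (b k i * star (b k j)) +
              if k = l then (m - a) * (b k i * star (b k j)) else 0 := by
          intro k
          split_ifs <;> ring
        simp only [h]
        rw [Finset.sum_add_distrib, ← Finset.mul_sum, hδ, Finset.sum_ite_eq' ]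
        simp

end Moments

/-! ### Response functions and their moment matrices -/

section Response

variable {n : Type*} [Fintype n]

/-- A response function: a measurable function with values in `[0, 1]` on the unit ball. -/
def IsResponse (W : EuclideanSpace ℂ n → ℝ) : Prop :=
  Measurable W ∧ ∀ z, ‖z‖ ≤ 1 → 0 ≤ W z ∧ W z ≤ 1

/-- The matrix of second moments of the unit ball with weight `W`. -/
noncomputable def momentMatrix (W : EuclideanSpace ℂ n → ℝ) : Matrix n n ℂ :=
  Matrix.of fun i j => ∫ z, (W z : ℂ) * (z i * star (z j)) ∂ballMeasure n

theorem IsResponse.integrable {W : EuclideanSpace ℂ n → ℝ} (hW : IsResponse W) (i j : n) :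
    MeasureTheory.Integrable (fun z : EuclideanSpace ℂ n => (W z : ℂ) * (z i * star (z j)))
      (ballMeasure n) := by
  refine integrable_ballMeasure (Measurable.aestronglyMeasurable ?_) 1 fun z hz => ?_
  · have h2 : ∀ k, Measurable fun z : EuclideanSpace ℂ n => z k := fun k => by fun_prop
    exact (Complex.measurable_ofReal.comp hW.1).mul
      ((h2 i).mul (continuous_star.measurable.comp (h2 j)))
  · have h := fun i => (EuclideanSpace.norm_apply_le z i).trans hz
    rw [norm_mul, norm_mul, norm_star, Complex.norm_real, Real.norm_eq_abs,
      abs_of_nonneg (hW.2 z hz).1]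
    exact mul_le_one₀ (hW.2 z hz).2 (by positivity) (mul_le_one₀ (h i) (norm_nonneg _) (h j))

theorem momentMatrix_sum {ι : Type*} (s : Finset ι) (c : ι → ℝ)
    {W : ι → EuclideanSpace ℂ n → ℝ} (hW : ∀ k ∈ s, IsResponse (W k)) :
    momentMatrix (fun z => ∑ k ∈ s, c k * W k z) = ∑ k ∈ s, (c k : ℂ) • momentMatrix (W k) := by
  ext i j
  simp only [momentMatrix, Matrix.of_apply, Matrix.sum_apply, Matrix.smul_apply, smul_eq_mul]
  simp_rw [← MeasureTheory.integral_const_mul]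
  rw [← MeasureTheory.integral_finsetSum _ fun k hk => ((hW k hk).integrable i j).const_mul _]
  refine MeasureTheory.integral_congr_ae (Filter.Eventually.of_forall fun z => ?_)
  simp only
  push_cast
  rw [Finset.sum_mul]
  exact Finset.sum_congr rfl fun _ _ => mul_assoc _ _ _

theorem IsResponse.posSemidef_momentMatrix {W : EuclideanSpace ℂ n → ℝ} (hW : IsResponse W) :
    (momentMatrix W).PosSemidef := by
  refine Matrix.PosSemidef.of_dotProduct_mulVec_nonneg ?_ fun x => ?_
  · ext i j
    rw [Matrix.conjTranspose_apply, momentMatrix, Matrix.of_apply, Matrix.of_apply, Complex.star_def,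
      ← integral_conj]
    refine MeasureTheory.integral_congr_ae (Filter.Eventually.of_forall fun z => ?_)
    simp [mul_comm]
  · have h : star x ⬝ᵥ (momentMatrix W).mulVec x =
        ∫ z, ((W z * ‖∑ i, star (x i) * z i‖ ^ 2 : ℝ) : ℂ) ∂ballMeasure n := by
      simp only [dotProduct, Matrix.mulVec, momentMatrix, Matrix.of_apply, Pi.star_apply,
        Finset.mul_sum]
      calc ∑ i, ∑ j, star (x i) *
            ((∫ z, (W z : ℂ) * (z i * star (z j)) ∂ballMeasure n) * x j)
          = ∑ i, ∑ j, ∫ z, star (x i) * ((W z : ℂ) * (z i * star (z j))) * x j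
              ∂ballMeasure n := by
            refine Finset.sum_congr rfl fun i _ => Finset.sum_congr rfl fun j _ => ?_
            rw [MeasureTheory.integral_mul_const, MeasureTheory.integral_const_mul, mul_assoc]
        _ = ∫ z, ∑ i, ∑ j, star (x i) * ((W z : ℂ) * (z i * star (z j))) * x j
              ∂ballMeasure n := by
            rw [MeasureTheory.integral_finsetSum _ fun i _ =>
              MeasureTheory.integrable_finsetSum _ fun j _ =>
                ((hW.integrable i j).const_mul _).mul_const _]
            refine Finset.sum_congr rfl fun i _ => ?_
            rw [MeasureTheory.integral_finsetSum _ fun j _ =>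
              ((hW.integrable i j).const_mul _).mul_const _]
        _ = _ := by
            refine MeasureTheory.integral_congr_ae (Filter.Eventually.of_forall fun z => ?_)
            simp only
            rw [Complex.ofReal_mul, Complex.ofReal_pow, ← Complex.mul_conj', ← Complex.star_def,
              star_sum, Finset.sum_mul_sum, Finset.mul_sum]
            refine Finset.sum_congr rfl fun i _ => ?_
            rw [Finset.mul_sum]
            refine Finset.sum_congr rfl fun j _ => ?_
            rw [star_mul', star_star]
            ring
    rw [h, integral_complex_ofReal]
    refine Complex.zero_le_real.mpr (MeasureTheory.integral_nonneg_of_ae ?_)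
    filter_upwards [ae_ballMeasure_norm_le_one n] with z hz
    exact mul_nonneg (hW.2 z hz).1 (sq_nonneg _)

theorem IsResponse.one : IsResponse fun _ : EuclideanSpace ℂ n => (1 : ℝ) :=
  ⟨measurable_const, fun _ _ => ⟨zero_le_one, le_rfl⟩⟩

theorem IsResponse.prod {ι : Type*} (s : Finset ι) {W : ι → EuclideanSpace ℂ n → ℝ}
    (hW : ∀ k ∈ s, IsResponse (W k)) : IsResponse fun z => ∏ k ∈ s, W k z :=
  ⟨Finset.measurable_fun_prod s fun k hk => (hW k hk).1, fun z hz =>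
    ⟨Finset.prod_nonneg fun k hk => ((hW k hk).2 z hz).1,
      Finset.prod_le_one (fun k hk => ((hW k hk).2 z hz).1) fun k hk => ((hW k hk).2 z hz).2⟩⟩

variable [DecidableEq n]

/-- A constant weight has no axis: computing one diagonal moment with two choices of axis in
`integral_coord_eq` shows that all diagonal moments agree. -/
theorem momentMatrix_one {i₀ i₁ : n} (h₀₁ : i₀ ≠ i₁) :
    momentMatrix (fun _ : EuclideanSpace ℂ n => (1 : ℝ)) =
      ((∫ z, ‖z i₀‖ ^ 2 ∂ballMeasure n : ℝ) : ℂ) • 1 := by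
  have key := integral_coord_eq (fun _ => (1 : ℝ)) h₀₁
  have h : (∫ z, ‖z i₀‖ ^ 2 ∂ballMeasure n) = ∫ z, ‖z i₁‖ ^ 2 ∂ballMeasure n := by
    have h1 := key i₀ i₁ i₁
    rw [key i₁ i₁ i₁] at h1
    simpa [h₀₁.symm] using h1
  ext i j
  rw [momentMatrix, Matrix.of_apply, key i₀]
  simp [Matrix.one_apply, ← h]

/-- The response function of an effect. -/
theorem exists_response_of_posSemidef {f : ℝ → ℝ} (hf : Measurable f)
    (hb : ∀ s, 0 ≤ s → 0 ≤ f s ∧ f s ≤ s) {i₀ i₁ : n} (h₀₁ : i₀ ≠ i₁) {A : Matrix n n ℂ}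
    (hA : A.PosSemidef) : ∃ R : EuclideanSpace ℂ n → ℝ, Measurable R ∧
      (∀ z, 0 ≤ R z ∧ R z ≤ (∑ i, ∑ j, star (z i) * A i j * z j).re) ∧
      momentMatrix R = (((∫ z, f (‖z i₀‖ ^ 2) * ‖z i₁‖ ^ 2 ∂ballMeasure n : ℝ) : ℂ) * A.trace) • 1 +
        ((∫ z, f (‖z i₀‖ ^ 2) * ‖z i₀‖ ^ 2 ∂ballMeasure n : ℝ) -
          (∫ z, f (‖z i₀‖ ^ 2) * ‖z i₁‖ ^ 2 ∂ballMeasure n : ℝ) : ℂ) • A := by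
  have hH := hA.1
  have hinner : ∀ l (z : EuclideanSpace ℂ n),
      inner ℂ (hH.eigenvectorBasis l) z = ∑ i, star (hH.eigenvectorBasis l i) * z i := by
    intro l z
    rw [PiLp.inner_apply]
    exact Finset.sum_congr rfl fun i _ => by simp [mul_comm]
  have hmeas : ∀ l, Measurable fun z : EuclideanSpace ℂ n =>
      f (‖(inner ℂ (hH.eigenvectorBasis l) z : ℂ)‖ ^ 2) := fun l => hf.comp (by fun_prop)
  -- Replacing f(s) by s would give exactly ⟨z, A z⟩; this is where f(s) ≤ s is needed.
  refine ⟨fun z => ∑ l, hH.eigenvalues l * f (‖(inner ℂ (hH.eigenvectorBasis l) z : ℂ)‖ ^ 2),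
    Finset.measurable_fun_sum _ fun l _ => (hmeas l).const_mul _, fun z => ⟨?_, ?_⟩, ?_⟩
  · exact Finset.sum_nonneg fun l _ => mul_nonneg (hA.eigenvalues_nonneg l) (hb _ (sq_nonneg _)).1
  · have h : ∑ i, ∑ j, star (z i) * A i j * z j =
        ((∑ l, hH.eigenvalues l * ‖(inner ℂ (hH.eigenvectorBasis l) z : ℂ)‖ ^ 2 : ℝ) : ℂ) := by
      simp only [hH.apply_eq_sum_eigenvalues, Finset.mul_sum, Finset.sum_mul]
      push_cast
      calc _ = ∑ l, ∑ i, ∑ j, star (z i) * ((hH.eigenvalues l : ℂ) *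
              (hH.eigenvectorBasis l i * star (hH.eigenvectorBasis l j))) * z j :=
            (Finset.sum_congr rfl fun i _ => Finset.sum_comm).trans Finset.sum_comm
        _ = _ := by
            refine Finset.sum_congr rfl fun l _ => ?_
            rw [← Complex.conj_mul', hinner, ← Complex.star_def, star_sum, Finset.sum_mul_sum,
              Finset.mul_sum]
            refine Finset.sum_congr rfl fun i _ => ?_
            rw [Finset.mul_sum]
            refine Finset.sum_congr rfl fun j _ => ?_
            rw [star_mul', star_star]
            ring
    rw [h, Complex.ofReal_re]
    exact Finset.sum_le_sum fun l _ =>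
      mul_le_mul_of_nonneg_left (hb _ (sq_nonneg _)).2 (hA.eigenvalues_nonneg l)
  · rw [momentMatrix_sum Finset.univ hH.eigenvalues fun l _ => ⟨hmeas l, fun z hz =>
      ⟨(hb _ (sq_nonneg _)).1, (hb _ (sq_nonneg _)).2.trans
        (norm_inner_sq_le_one (hH.eigenvectorBasis.orthonormal.1 l) hz)⟩⟩]
    ext i j
    rw [Matrix.sum_apply]
    have hb' : ∀ s, 0 ≤ s → s ≤ 1 → |f s| ≤ 1 := fun s h0 h1 => by
      rw [abs_of_nonneg (hb s h0).1]
      exact (hb s h0).2.trans h1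
    simp only [Matrix.smul_apply, momentMatrix, Matrix.of_apply,
      integral_inner_eq f hf hb' h₀₁, Matrix.add_apply, smul_eq_mul]
    rw [hH.apply_eq_sum_eigenvalues i j, hH.trace_eq_sum_eigenvalues, Matrix.one_apply]
    simp only [mul_add, Finset.sum_add_distrib, Finset.mul_sum, Finset.sum_mul]
    congr 1
    · refine Finset.sum_congr rfl fun l _ => ?_
      split_ifs <;> simp [mul_comm]
    · refine Finset.sum_congr rfl fun l _ => ?_
      ring

/-- A threshold weight concentrated near the pole has almost no moment orthogonal to the axis. -/
theorem exists_threshold_weight {i₀ i₁ : n} (h₀₁ : i₀ ≠ i₁) {ε : ℝ} (hε : 0 < ε) :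
    ∃ f : ℝ → ℝ, Measurable f ∧ (∀ s, 0 ≤ s → 0 ≤ f s ∧ f s ≤ s) ∧
      0 < (∫ z, f (‖z i₀‖ ^ 2) * ‖z i₀‖ ^ 2 ∂ballMeasure n) -
        ∫ z, f (‖z i₀‖ ^ 2) * ‖z i₁‖ ^ 2 ∂ballMeasure n ∧
      (∫ z, f (‖z i₀‖ ^ 2) * ‖z i₁‖ ^ 2 ∂ballMeasure n) ≤
        ε * ((∫ z, f (‖z i₀‖ ^ 2) * ‖z i₀‖ ^ 2 ∂ballMeasure n) -
          ∫ z, f (‖z i₀‖ ^ 2) * ‖z i₁‖ ^ 2 ∂ballMeasure n) := by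
  -- This t solves 1 - t = ε (2t - 1). With F = ∫ f(|z_{i₀}|²), the moment across the axis is at
  -- most (1 - t) F and the one along it at least t F, so their difference is at least (2t - 1) F.
  set t : ℝ := 1 - ε / (1 + 2 * ε) with ht
  have h12 : 0 < 1 + 2 * ε := by linarith
  have ht0 : 1 - t = ε * (2 * t - 1) := by rw [ht]; field_simp; ring
  have ht1 : 0 < 2 * t - 1 := by
    have : 2 * t - 1 = 1 / (1 + 2 * ε) := by rw [ht]; field_simp; ring
    rw [this]; positivity
  have htlt : t < 1 := by
    have := mul_pos hε ht1
    linarith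
  have hmeas : Measurable fun s : ℝ => if t ≤ s then s else 0 :=
    Measurable.ite measurableSet_Ici measurable_id measurable_const
  set f : ℝ → ℝ := fun s => if t ≤ s then s else 0 with hf
  have hb : ∀ s, 0 ≤ s → 0 ≤ f s ∧ f s ≤ s := fun s hs => by
    simp only [hf]
    split_ifs <;> exact ⟨by linarith, by linarith⟩
  have hc : ∀ z : EuclideanSpace ℂ n, ‖z‖ ≤ 1 → ∀ i, ‖z i‖ ^ 2 ≤ 1 := fun z hz i =>
    pow_le_one₀ (norm_nonneg _) ((EuclideanSpace.norm_apply_le z i).trans hz)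
  have hfm : Measurable fun z : EuclideanSpace ℂ n => f (‖z i₀‖ ^ 2) := hmeas.comp (by fun_prop)
  have hint : ∀ i, MeasureTheory.Integrable
      (fun z : EuclideanSpace ℂ n => f (‖z i₀‖ ^ 2) * ‖z i‖ ^ 2) (ballMeasure n) := by
    intro i
    refine integrable_ballMeasure (hfm.mul (by fun_prop)).aestronglyMeasurable 1 fun z hz => ?_
    have h0 := hb (‖z i₀‖ ^ 2) (sq_nonneg _)
    rw [Real.norm_eq_abs, abs_of_nonneg (mul_nonneg h0.1 (sq_nonneg _))]
    exact mul_le_one₀ (h0.2.trans (hc z hz _)) (sq_nonneg _) (hc z hz _)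
  have hintf : MeasureTheory.Integrable
      (fun z : EuclideanSpace ℂ n => f (‖z i₀‖ ^ 2)) (ballMeasure n) := by
    refine integrable_ballMeasure hfm.aestronglyMeasurable 1 fun z hz => ?_
    have h0 := hb (‖z i₀‖ ^ 2) (sq_nonneg _)
    rw [Real.norm_eq_abs, abs_of_nonneg h0.1]
    exact h0.2.trans (hc z hz _)
  have hpos : 0 < ∫ z, f (‖z i₀‖ ^ 2) ∂ballMeasure n := by
    rw [MeasureTheory.integral_pos_iff_support_of_nonneg (fun z => (hb _ (sq_nonneg _)).1) hintf]
    let O : Set (EuclideanSpace ℂ n) := {z | t < ‖z i₀‖ ^ 2} ∩ Metric.ball 0 1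
    have hO : IsOpen O :=
      (isOpen_lt continuous_const (by fun_prop)).inter Metric.isOpen_ball
    have hne : O.Nonempty := by
      have hs : 0 ≤ (1 + t) / 2 := by linarith
      refine ⟨EuclideanSpace.single i₀ ((Real.sqrt ((1 + t) / 2) : ℝ) : ℂ), ?_, ?_⟩
      · simp only [Set.mem_ofPred_eq, PiLp.single_apply, if_true, Complex.norm_real,
          Real.norm_eq_abs, sq_abs, Real.sq_sqrt hs]
        linarith
      · rw [mem_ball_zero_iff, PiLp.norm_single, Complex.norm_real, Real.norm_eq_abs,
          abs_of_nonneg (Real.sqrt_nonneg _), Real.sqrt_lt' one_pos]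
        linarith
    have h1 := hO.measure_pos MeasureTheory.volume hne
    refine h1.trans_le ?_
    rw [ballMeasure]
    refine le_trans ?_ (MeasureTheory.Measure.le_restrict_apply _ _)
    refine MeasureTheory.measure_mono fun z hz => ⟨?_, Metric.ball_subset_closedBall hz.2⟩
    have hz1 : t < ‖z i₀‖ ^ 2 := hz.1
    simp only [Function.mem_support, hf, if_pos hz1.le]
    linarith
  have ha : (∫ z, f (‖z i₀‖ ^ 2) * ‖z i₁‖ ^ 2 ∂ballMeasure n) ≤
      (1 - t) * ∫ z, f (‖z i₀‖ ^ 2) ∂ballMeasure n := by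
    rw [← MeasureTheory.integral_const_mul]
    refine MeasureTheory.integral_mono_ae (hint i₁) (hintf.const_mul _) ?_
    filter_upwards [ae_ballMeasure_norm_le_one n] with z hz
    by_cases h : t ≤ ‖z i₀‖ ^ 2
    -- In the ball, |z_{i₀}|² ≥ t leaves at most 1 - t for |z_{i₁}|².
    · have h1 : ‖z i₀‖ ^ 2 + ‖z i₁‖ ^ 2 ≤ 1 := by
        have h2 : ∑ i ∈ {i₀, i₁}, ‖z i‖ ^ 2 ≤ ‖z‖ ^ 2 := by
          rw [EuclideanSpace.norm_sq_eq]
          exact Finset.sum_le_sum_of_subset_of_nonneg (Finset.subset_univ _)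
            fun _ _ _ => sq_nonneg _
        rw [Finset.sum_pair h₀₁] at h2
        exact h2.trans (pow_le_one₀ (norm_nonneg _) hz)
      rw [mul_comm]
      exact mul_le_mul_of_nonneg_right (by linarith) (hb _ (sq_nonneg _)).1
    · simp [hf, h]
  have hm : t * (∫ z, f (‖z i₀‖ ^ 2) ∂ballMeasure n) ≤
      ∫ z, f (‖z i₀‖ ^ 2) * ‖z i₀‖ ^ 2 ∂ballMeasure n := by
    rw [← MeasureTheory.integral_const_mul]
    refine MeasureTheory.integral_mono_ae (hintf.const_mul _) (hint i₀)
      (Filter.Eventually.of_forall fun z => ?_)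
    by_cases h : t ≤ ‖z i₀‖ ^ 2
    · simp only
      rw [mul_comm]
      exact mul_le_mul_of_nonneg_left h (hb _ (sq_nonneg _)).1
    · simp [hf, h]
  have hd : (2 * t - 1) * (∫ z, f (‖z i₀‖ ^ 2) ∂ballMeasure n) ≤
      (∫ z, f (‖z i₀‖ ^ 2) * ‖z i₀‖ ^ 2 ∂ballMeasure n) -
        ∫ z, f (‖z i₀‖ ^ 2) * ‖z i₁‖ ^ 2 ∂ballMeasure n := by linarith
  refine ⟨f, hmeas, hb, (mul_pos ht1 hpos).trans_le hd, ha.trans ?_⟩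
  rw [ht0, mul_assoc]
  exact mul_le_mul_of_nonneg_left hd hε.le

end Response

/-! ### From response functions to incompatibility breaking -/

theorem jointlyMeasurable_of_fintype {a s o ι : Type*} [Fintype a] [DecidableEq a] [Fintype o]
    [Fintype ι] {N : s → o → Matrix a a ℂ} (G : ι → Matrix a a ℂ) (p : s → ι → o → ℝ)
    (hG : IsPOVM G) (hp : ∀ y i b, 0 ≤ p y i b) (hp1 : ∀ y i, ∑ b, p y i b = 1)
    (h : ∀ y b, N y b = ∑ i, (p y i b : ℂ) • G i) : JointlyMeasurable N := by
  let e := Fintype.equivFin ι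
  refine ⟨Fintype.card ι, fun i => G (e.symm i), fun y i => p y (e.symm i),
    ⟨fun i => hG.1 _, ?_⟩, fun y i => hp y _, fun y i => hp1 y _, fun y b => ?_⟩
  · rw [e.symm.sum_comp G, hG.2]
  · rw [e.symm.sum_comp fun i => (p y i b : ℂ) • G i, h]

/-- Marginal of a product of conditional distributions. -/
theorem sum_ite_mul_prod_eq {ι κ : Type*} [Fintype ι] [DecidableEq ι] [Fintype κ] [DecidableEq κ]
    (p : ι → κ → ℝ) (hp : ∀ i, ∑ k, p i k = 1) (y : ι) (b : κ) :
    ∑ l : ι → κ, (if l y = b then 1 else 0) * ∏ i, p i (l i) = p y b := by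
  have h : ∀ l : ι → κ, (if l y = b then 1 else 0) * ∏ i, p i (l i) =
      ∏ i, (if i = y then (if l i = b then 1 else 0) else 1) * p i (l i) := by
    intro l
    rw [Finset.prod_mul_distrib, Finset.prod_ite_eq']
    simp
  simp only [h]
  rw [← Fintype.piFinset_univ, ← Finset.prod_univ_sum (fun _ => Finset.univ)
    fun i k => (if i = y then (if k = b then 1 else 0) else 1) * p i k]
  rw [Finset.prod_eq_single y]
  · simp
  · intro i _ hi
    simp [hi, hp]
  · simp

/-- A family of classical response functions to the parent measure `|z⟩⟨z| dz` on the unit ball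
gives a jointly measurable family. -/
theorem jointlyMeasurable_of_response {n : Type*} [Fintype n] [DecidableEq n] {s o : Type*}
    [Fintype s] [DecidableEq s] [Fintype o] [DecidableEq o] {c : ℝ} (hc : 0 ≤ c)
    (h1 : (c : ℂ) • momentMatrix (fun _ : EuclideanSpace ℂ n => (1 : ℝ)) = 1)
    (p : s → o → EuclideanSpace ℂ n → ℝ) (hp : ∀ y b, IsResponse (p y b))
    (hp1 : ∀ y z, ∑ b, p y b z = 1) :
    JointlyMeasurable fun y b => (c : ℂ) • momentMatrix (p y b) := by
  have hresp : ∀ l : s → o, IsResponse fun z => ∏ y, p y (l y) z :=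
    fun l => IsResponse.prod _ fun y _ => hp y (l y)
  -- A finite parent replaces the continuous one: given z, outcomes for all settings are drawn
  -- independently, and only the list l of outcomes is kept. Each measurement is recovered by
  -- reading off l y.
  refine jointlyMeasurable_of_fintype
    (fun l : s → o => (c : ℂ) • momentMatrix fun z => ∏ y, p y (l y) z)
    (fun y l b => if l y = b then 1 else 0)
    ⟨fun l => (hresp l).posSemidef_momentMatrix.smul (by exact_mod_cast hc), ?_⟩
    (fun y l b => by split_ifs <;> norm_num) (fun y l => by simp) (fun y b => ?_)
  · have h := momentMatrix_sum Finset.univ (fun _ => (1 : ℝ)) fun l _ => hresp l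
    rw [← Finset.smul_sum, ← h1]
    congr 1
    simp only [Complex.ofReal_one, one_smul, one_mul] at h
    rw [← h]
    congr 1
    ext z
    rw [← Fintype.piFinset_univ, ← Finset.prod_univ_sum (fun _ => Finset.univ)
      fun y b => p y b z]
    exact Finset.prod_eq_one fun y _ => hp1 y z
  · have h := momentMatrix_sum Finset.univ (fun l : s → o => if l y = b then (1 : ℝ) else 0)
      fun l _ => hresp l
    simp only [sum_ite_mul_prod_eq (fun y b => p y b _) (fun y => hp1 y _) y b] at h
    rw [show p y b = fun z => p y b z from rfl, h, Finset.smul_sum]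
    exact Finset.sum_congr rfl fun l _ => smul_comm _ _ _

/-- Incompatibility-breaking channels with an arbitrarily small admixture of noise. -/
theorem exists_incompatibilityBreaking {d : ℕ} (hd : 2 ≤ d) {ε : ℝ} (hε : 0 < ε) :
    ∃ u v w : ℝ, 0 < u ∧ 0 ≤ v ∧ 0 ≤ w ∧ v ≤ ε * u ∧ u + d * v + w = 1 ∧
      IncompatibilityBreaking (lossyDepolarizing d u v w) := by
  let i₀ : Fin d := ⟨0, by omega⟩
  let i₁ : Fin d := ⟨1, by omega⟩
  have h₀₁ : i₀ ≠ i₁ := by simp [i₀, i₁, Fin.ext_iff]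
  obtain ⟨f, hf, hb, hpos, hle⟩ := exists_threshold_weight h₀₁ hε
  have hresp := fun (A : Matrix (Fin d) (Fin d) ℂ) (hA : A.PosSemidef) =>
    exists_response_of_posSemidef hf hb h₀₁ hA
  have hone := momentMatrix_one h₀₁
  set m : ℝ := ∫ z, f (‖z i₀‖ ^ 2) * ‖z i₀‖ ^ 2 ∂ballMeasure (Fin d) with hm
  set a : ℝ := ∫ z, f (‖z i₀‖ ^ 2) * ‖z i₁‖ ^ 2 ∂ballMeasure (Fin d) with ha
  set g : ℝ := ∫ z, ‖z i₀‖ ^ 2 ∂ballMeasure (Fin d) with hg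
  have ha0 : 0 ≤ a := MeasureTheory.integral_nonneg fun z =>
    mul_nonneg (hb _ (sq_nonneg _)).1 (sq_nonneg _)
  -- The response R of the identity effect satisfies R ≤ ‖z‖² ≤ 1, so 1 - R has a positive
  -- semidefinite moment matrix; a diagonal entry gives the bound. It yields w ≥ 0 and, since m - a
  -- > 0, also g > 0.
  have hsum : (m - a) + d * a ≤ g := by
    obtain ⟨R, hR, hR2, hR3⟩ := hresp 1 Matrix.PosSemidef.one
    have hz : ∀ z : EuclideanSpace ℂ (Fin d), R z ≤ ‖z‖ ^ 2 := by
      intro z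
      refine (hR2 z).2.trans (le_of_eq ?_)
      rw [EuclideanSpace.norm_sq_eq]
      simp only [Matrix.one_apply, mul_ite, mul_one, mul_zero, ite_mul, zero_mul,
        Finset.sum_ite_eq, Finset.mem_univ, if_true, Complex.re_sum]
      refine Finset.sum_congr rfl fun i _ => ?_
      rw [Complex.star_def, Complex.conj_mul', ← Complex.ofReal_pow, Complex.ofReal_re]
    have hz1 : ∀ z : EuclideanSpace ℂ (Fin d), ‖z‖ ≤ 1 → R z ≤ 1 := fun z h =>
      (hz z).trans (pow_le_one₀ (norm_nonneg _) h)
    have h1 : IsResponse fun z => 1 - R z := ⟨measurable_const.sub hR, fun z h =>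
      ⟨by linarith [hz1 z h], by linarith [(hR2 z).1]⟩⟩
    have h2 : momentMatrix (fun z => 1 - R z) =
        momentMatrix (fun _ : EuclideanSpace ℂ (Fin d) => (1 : ℝ)) - momentMatrix R := by
      have := momentMatrix_sum Finset.univ (![1, -1] : Fin 2 → ℝ) (W := ![fun _ => 1, R])
        (by intro k _; fin_cases k
            · exact IsResponse.one
            · exact ⟨hR, fun z h => ⟨(hR2 z).1, hz1 z h⟩⟩)
      simpa [Fin.sum_univ_two, sub_eq_add_neg] using this
    have h3 := (h1.posSemidef_momentMatrix).diag_nonneg (i := i₀)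
    rw [h2, hone, hR3, Matrix.trace_one] at h3
    simp only [Matrix.sub_apply, Matrix.add_apply, Matrix.smul_apply, Matrix.one_apply_eq,
      Fintype.card_fin, smul_eq_mul, mul_one] at h3
    have h4 : (0 : ℝ) ≤ g - (a * d + (m - a)) := by exact_mod_cast h3
    linarith
  have hg0 : 0 < g := lt_of_lt_of_le (by positivity) hsum
  refine ⟨(m - a) / g, a / g, 1 - ((m - a) / g + d * (a / g)), div_pos hpos hg0,
    div_nonneg ha0 hg0.le, ?_, ?_, by ring, fun μ ν M hM => ?_⟩
  · rw [sub_nonneg, show (m - a) / g + d * (a / g) = ((m - a) + d * a) / g by ring,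
      div_le_one hg0]
    exact hsum
  · rw [← mul_div_assoc]
    exact div_le_div_of_nonneg_right hle hg0.le
  set V := embedMatrix d with hV
  have hA : ∀ y b, (V.conjTranspose * M y b * V).PosSemidef := fun y b =>
    ((hM y).1 b).conjTranspose_mul_mul_same V
  choose R hRm hR hRmom using fun y b => hresp _ (hA y b)
  let q : Fin μ → Fin ν → ℝ := fun y b => (M y b (Fin.last d) (Fin.last d)).re
  have hqC : ∀ y b, ((q y b : ℝ) : ℂ) = M y b (Fin.last d) (Fin.last d) := fun y b =>
    (Complex.eq_re_of_ofReal_le (r := 0) (by simpa using ((hM y).1 b).diag_nonneg)).symm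
  have hq0 : ∀ y b, 0 ≤ q y b := fun y b =>
    (Complex.nonneg_iff.mp ((hM y).1 b).diag_nonneg).1
  have hq1 : ∀ y, ∑ b, q y b = 1 := fun y => by
    have h := congrArg (fun X : Matrix _ _ ℂ => X (Fin.last d) (Fin.last d)) (hM y).2
    simp only [Matrix.sum_apply, Matrix.one_apply_eq, ← hqC] at h
    exact_mod_cast h
  have hAsum : ∀ y, ∑ b, V.conjTranspose * M y b * V = 1 := fun y => by
    rw [← Matrix.sum_mul, ← Matrix.mul_sum, (hM y).2, Matrix.mul_one,
      embedMatrix_conjTranspose_mul_self]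
  have hRsum : ∀ y z, ∑ b, R y b z ≤ ‖z‖ ^ 2 := by
    intro y z
    refine (Finset.sum_le_sum fun b _ => (hR y b z).2).trans (le_of_eq ?_)
    rw [← Complex.re_sum, Finset.sum_comm]
    have h : ∀ i, ∑ b, ∑ j, star (z i) * (V.conjTranspose * M y b * V) i j * z j =
        ((‖z i‖ ^ 2 : ℝ) : ℂ) := by
      intro i
      rw [Finset.sum_comm]
      simp only [← Finset.sum_mul, ← Finset.mul_sum, ← Matrix.sum_apply, hAsum, Matrix.one_apply]
      simp [Complex.conj_mul']
    simp only [h]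
    rw [EuclideanSpace.norm_sq_eq, ← Complex.ofReal_sum, Complex.ofReal_re]
  have hR1 : ∀ y z, ‖z‖ ≤ 1 → ∑ b, R y b z ≤ 1 := fun y z hz =>
    (hRsum y z).trans (pow_le_one₀ (norm_nonneg _) hz)
  have hRresp : ∀ y b, IsResponse (R y b) := fun y b => ⟨hRm y b, fun z hz => ⟨(hR y b z).1,
    (Finset.single_le_sum (fun b _ => (hR y b z).1) (Finset.mem_univ b)).trans (hR1 y z hz)⟩⟩
  -- When no outcome responds, one is drawn with the probability q that M y gives on the flag state;
  -- this simulates the erasure branch.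
  let p : Fin μ → Fin ν → EuclideanSpace ℂ (Fin d) → ℝ := fun y b z =>
    R y b z + q y b * (1 - ∑ b', R y b' z)
  have hp1 : ∀ y z, ∑ b, p y b z = 1 := fun y z => by
    simp only [p]
    rw [Finset.sum_add_distrib, ← Finset.sum_mul, hq1]
    ring
  have hp0 : ∀ y b z, ‖z‖ ≤ 1 → 0 ≤ p y b z := fun y b z hz =>
    add_nonneg (hR y b z).1 (mul_nonneg (hq0 y b) (by linarith [hR1 y z hz]))
  have hp : ∀ y b, IsResponse (p y b) := fun y b =>
    ⟨(hRm y b).add ((measurable_const.sub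
      (Finset.measurable_fun_sum _ fun b' _ => hRm y b')).const_mul _), fun z hz =>
      ⟨hp0 y b z hz, (Finset.single_le_sum (fun b _ => hp0 y b z hz)
        (Finset.mem_univ b)).trans (hp1 y z).le⟩⟩
  have key := jointlyMeasurable_of_response (c := g⁻¹) (inv_nonneg.mpr hg0.le)
    (by rw [hone, smul_smul, ← Complex.ofReal_mul, inv_mul_cancel₀ hg0.ne', Complex.ofReal_one,
      one_smul]) p hp hp1
  -- It remains to compare coefficients: A carries (m - a)/g = u, the term tr(A) 1 carries a/g = v,
  -- and q 1 carries 1 - (u + d v) = w.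
  convert key using 3 with y b
  have hmom : momentMatrix (p y b) = momentMatrix (R y b) + (q y b : ℂ) •
      (momentMatrix (fun _ : EuclideanSpace ℂ (Fin d) => (1 : ℝ)) -
        ∑ b', momentMatrix (R y b')) := by
    -- The index type lists the terms of p: R y b, the constant 1 with coefficient q, and each R y
    -- b' with coefficient -q.
    have h := momentMatrix_sum (Finset.univ : Finset (Option (Option (Fin ν))))
      (fun k => k.elim 1 fun k' => k'.elim (q y b) fun _ => -q y b)
      (W := fun k => k.elim (R y b) fun k' => k'.elim (fun _ => 1) fun b' => R y b')
      (by rintro (_ | _ | b') _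
          · exact hRresp y b
          · exact IsResponse.one
          · exact hRresp y b')
    simp only [Fintype.sum_option, Option.elim_none, Option.elim_some, Complex.ofReal_one, one_smul,
      one_mul, mul_one, Complex.ofReal_neg, neg_smul, neg_mul, Finset.sum_neg_distrib,
      ← Finset.mul_sum, ← Finset.smul_sum] at h
    rw [smul_sub, sub_eq_add_neg, ← h]
    congr 1
    ext z
    simp only [p]
    ring
  have hmsum : ∑ b', momentMatrix (R y b') = ((a * d + (m - a) : ℝ) : ℂ) • 1 := by
    simp only [hRmom, Finset.sum_add_distrib, ← Finset.sum_smul, ← Finset.smul_sum,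
      ← Finset.mul_sum, ← Matrix.trace_sum, hAsum, Matrix.trace_one, Fintype.card_fin]
    rw [← add_smul]
    push_cast
    rfl
  have hgC : (g : ℂ) ≠ 0 := by exact_mod_cast hg0.ne'
  ext i j
  rw [heisenberg_lossyDepolarizing, hmom, hmsum, hRmom, hone, ← hqC]
  simp only [Matrix.smul_apply, Matrix.add_apply, Matrix.sub_apply, Matrix.one_apply, smul_eq_mul]
  push_cast
  split_ifs
  · field_simp
    ring
  · field_simp
    ring

/-! ### The Bell measurement and the isotropic state it prepares -/

/-- The unnormalised maximally entangled vector of the `d`-dimensional blocks of two systems of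
dimension `d + 1`. -/
def blockBell (d : ℕ) (s : Fin (d + 1) × Fin (d + 1)) : ℂ :=
  if s.1 = s.2 ∧ s.1 ≠ Fin.last d then 1 else 0

theorem sum_blockBell_mul (d : ℕ) (F : Fin (d + 1) × Fin (d + 1) → ℂ) :
    ∑ s, blockBell d s * F s = ∑ i : Fin d, F (i.castSucc, i.castSucc) := by
  rw [Fintype.sum_prod_type, Fin.sum_univ_castSucc]
  simp [blockBell]

/-- The projection on the maximally entangled state of the `d`-dimensional blocks. -/
noncomputable def bellProjection (d : ℕ) :
    Matrix (Fin (d + 1) × Fin (d + 1)) (Fin (d + 1) × Fin (d + 1)) ℂ :=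
  (d : ℂ)⁻¹ • Matrix.vecMulVec (blockBell d) (star (blockBell d))

theorem star_blockBell (d : ℕ) : star (blockBell d) = blockBell d := by
  ext s
  simp only [Pi.star_apply, blockBell]
  split_ifs <;> simp

theorem bellProjection_apply (d : ℕ) (s t : Fin (d + 1) × Fin (d + 1)) :
    bellProjection d s t = (d : ℂ)⁻¹ * (blockBell d s * blockBell d t) := by
  rw [bellProjection, star_blockBell, Matrix.smul_apply, Matrix.vecMulVec_apply, smul_eq_mul]

theorem posSemidef_bellProjection (d : ℕ) : (bellProjection d).PosSemidef :=
  (Matrix.posSemidef_vecMulVec_self_star _).smul (by positivity)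

theorem bellProjection_mul_self {d : ℕ} (hd : d ≠ 0) :
    bellProjection d * bellProjection d = bellProjection d := by
  have hd' : (d : ℂ) ≠ 0 := by exact_mod_cast hd
  ext s t
  rw [Matrix.mul_apply]
  simp only [bellProjection_apply]
  have h : ∀ r, (d : ℂ)⁻¹ * (blockBell d s * blockBell d r) *
      ((d : ℂ)⁻¹ * (blockBell d r * blockBell d t)) = blockBell d r * (blockBell d r *
        ((d : ℂ)⁻¹ * (d : ℂ)⁻¹ * blockBell d s * blockBell d t)) := fun r => by ring
  simp only [h, sum_blockBell_mul]
  simp only [blockBell, true_and, ne_eq, Fin.castSucc_ne_last, not_false_eq_true, if_true, one_mul,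
    Finset.sum_const, Finset.card_univ, Fintype.card_fin, nsmul_eq_mul]
  field_simp

theorem isPOVM_bellProjection {d : ℕ} (hd : d ≠ 0) :
    IsPOVM ![bellProjection d, 1 - bellProjection d] := by
  refine ⟨fun i => ?_, by simp [Fin.sum_univ_two]⟩
  fin_cases i
  · exact posSemidef_bellProjection d
  · have h : (1 - bellProjection d) * (1 - bellProjection d).conjTranspose =
        1 - bellProjection d := by
      rw [Matrix.conjTranspose_sub, Matrix.conjTranspose_one, (posSemidef_bellProjection d).1.eq,
        Matrix.mul_sub, Matrix.sub_mul, Matrix.sub_mul, Matrix.mul_one, Matrix.mul_one,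
        Matrix.one_mul, bellProjection_mul_self hd, sub_self, sub_zero]
    have := Matrix.posSemidef_self_mul_conjTranspose (1 - bellProjection d)
    rwa [h] at this

theorem idTensor_lossyDepolarizing_maxEntangled (d : ℕ) (u v w : ℝ) (i j x y : Fin d) :
    idTensor (Fin d) (lossyDepolarizing d u v w) (maxEntangled d) (i, x.castSucc) (j, y.castSucc) =
      (d : ℂ)⁻¹ * (u * ((if i = x then 1 else 0) * (if j = y then 1 else 0)) +
        v * ((if i = j then 1 else 0) * (if x = y then 1 else 0))) := by
  have h1 := embedMatrix_mul_mul_apply_castSucc d 1 x y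
  rw [Matrix.mul_one] at h1
  rw [idTensor, Matrix.of_apply, lossyDepolarizing_apply]
  simp only [Matrix.add_apply, Matrix.smul_apply, embedMatrix_mul_mul_apply_castSucc, h1,
    smul_eq_mul]
  have h2 : (Matrix.of fun x y : Fin d => maxEntangled d (i, x) (j, y)).trace =
      (d : ℂ)⁻¹ * if i = j then 1 else 0 := by
    simp only [Matrix.trace, Matrix.diag, Matrix.of_apply, maxEntangled]
    by_cases hij : i = j
    · subst hij
      simp
    · rw [if_neg hij, mul_zero]
      exact Finset.sum_eq_zero fun k _ => if_neg fun h => hij (h.1.trans h.2.symm)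
  have h3 : Matrix.single (Fin.last d) (Fin.last d) (1 : ℂ) x.castSucc y.castSucc = 0 := by
    rw [Matrix.single_apply_of_ne]
    exact fun h => (Fin.castSucc_ne_last x) h.1.symm
  rw [h2, h3, Matrix.one_apply, maxEntangled, Matrix.of_apply, Matrix.of_apply]
  split_ifs <;> simp_all <;> ring

/-- The Bell vector is supported on the unflagged blocks, so w drops out. Entanglement swapping of
the two u-parts gives the maximally entangled term; both cross terms and the v²-term give white
noise. -/
theorem endpointEnsemble_lossyDepolarizing (d : ℕ) (u v w : ℝ)
    (N : Matrix (Fin (d + 1) × Fin (d + 1)) (Fin (d + 1) × Fin (d + 1)) ℂ) (x y : Fin d × Fin d) :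
    endpointEnsemble (idTensor (Fin d) (lossyDepolarizing d u v w) (maxEntangled d))
      (idTensor (Fin d) (lossyDepolarizing d u v w) (maxEntangled d)) ![bellProjection d, N] 0 x y =
      ((u ^ 2 / d ^ 3 : ℝ) : ℂ) * ((if x.1 = x.2 then 1 else 0) * (if y.1 = y.2 then 1 else 0)) +
        (((2 * u * v + d * v ^ 2) / d ^ 3 : ℝ) : ℂ) * (if x = y then 1 else 0) := by
  rw [endpointEnsemble_apply]
  simp only [Matrix.cons_val_zero, bellProjection_apply]
  have h : ∀ s t : Fin (d + 1) × Fin (d + 1), ∀ F : ℂ,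
      (d : ℂ)⁻¹ * (blockBell d s * blockBell d t) * F =
        blockBell d s * (blockBell d t * ((d : ℂ)⁻¹ * F)) := fun s t F => by ring
  simp only [h]
  simp only [← Finset.mul_sum, sum_blockBell_mul, idTensor_lossyDepolarizing_maxEntangled]
  obtain ⟨i, i'⟩ := x
  obtain ⟨j, j'⟩ := y
  have key : ∑ s : Fin d, ∑ t : Fin d,
      (((u : ℂ) * ((if i = t then 1 else 0) * (if j = s then 1 else 0)) +
        v * ((if i = j then 1 else 0) * (if t = s then 1 else 0))) *
      ((u : ℂ) * ((if i' = t then 1 else 0) * (if j' = s then 1 else 0)) +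
        v * ((if i' = j' then 1 else 0) * (if t = s then 1 else 0)))) =
      (u : ℂ) ^ 2 * ((if i = i' then 1 else 0) * (if j = j' then 1 else 0)) +
        (2 * u * v + d * v ^ 2) * ((if i = j then 1 else 0) * (if i' = j' then 1 else 0)) := by
    have h1 : ∑ s : Fin d, ∑ t : Fin d,
        ((u : ℂ) * ((if i = t then 1 else 0) * (if j = s then 1 else 0))) *
        ((u : ℂ) * ((if i' = t then 1 else 0) * (if j' = s then 1 else 0))) =
        (u : ℂ) ^ 2 * ((if i = i' then 1 else 0) * (if j = j' then 1 else 0)) := by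
      rw [Finset.sum_eq_single j, Finset.sum_eq_single i]
      · simp [eq_comm, pow_two]
      · intro t _ ht
        simp [ht.symm]
      · simp
      · intro s _ hs
        simp [hs.symm]
      · simp
    have h2 : ∀ (i j i' j' : Fin d), ∑ s : Fin d, ∑ t : Fin d,
        ((u : ℂ) * ((if i = t then 1 else 0) * (if j = s then 1 else 0))) *
        ((v : ℂ) * ((if i' = j' then 1 else 0) * (if t = s then 1 else 0))) =
        (u * v : ℂ) * ((if i = j then 1 else 0) * (if i' = j' then 1 else 0)) := by
      intro i j i' j'
      rw [Finset.sum_eq_single j, Finset.sum_eq_single i]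
      · by_cases h : i = j <;> simp [h]
      · intro t _ ht
        simp [ht.symm]
      · simp
      · intro s _ hs
        simp [hs.symm]
      · simp
    have h3 : ∑ s : Fin d, ∑ t : Fin d,
        ((v : ℂ) * ((if i = j then 1 else 0) * (if t = s then 1 else 0))) *
        ((v : ℂ) * ((if i' = j' then 1 else 0) * (if t = s then 1 else 0))) =
        d * v ^ 2 * ((if i = j then 1 else 0) * (if i' = j' then 1 else 0)) := by
      by_cases h : i = j <;> by_cases h' : i' = j' <;> simp [h, h', pow_two]
    have h2' := h2 i' j' i j
    simp only [add_mul, mul_add, Finset.sum_add_distrib, h1, h2 i j i' j', h3]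
    rw [show ∑ s : Fin d, ∑ t : Fin d,
        ((v : ℂ) * ((if i = j then 1 else 0) * (if t = s then 1 else 0))) *
        ((u : ℂ) * ((if i' = t then 1 else 0) * (if j' = s then 1 else 0))) =
        (u * v : ℂ) * ((if i' = j' then 1 else 0) * (if i = j then 1 else 0)) by
      rw [← h2']
      exact Finset.sum_congr rfl fun _ _ => Finset.sum_congr rfl fun _ _ => mul_comm _ _]
    ring
  have h2 : ∀ P Q : ℂ, (d : ℂ)⁻¹ * P * ((d : ℂ)⁻¹ * Q) =
      ((d : ℂ)⁻¹) ^ 2 * (P * Q) := fun P Q => by ring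
  simp only [h2, ← Finset.mul_sum, key]
  have h3 : (if (i, i') = (j, j') then (1 : ℂ) else 0) =
      (if i = j then 1 else 0) * (if i' = j' then 1 else 0) := by
    by_cases h : i = j <;> simp [h]
  rw [h3]
  push_cast
  ring

/-- Overlap with the maximally entangled state and trace of an unnormalised isotropic state. -/
theorem sum_diag_and_trace_of_isotropic {d : ℕ} {α γ : ℝ}
    {σ : Matrix (Fin d × Fin d) (Fin d × Fin d) ℂ}
    (h : ∀ x y, σ x y = (α : ℂ) * ((if x.1 = x.2 then 1 else 0) * (if y.1 = y.2 then 1 else 0)) +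
      (γ : ℂ) * (if x = y then 1 else 0)) :
    ∑ i, ∑ j, σ (i, i) (j, j) = ((α * d ^ 2 + γ * d : ℝ) : ℂ) ∧
      σ.trace = ((α * d + γ * d ^ 2 : ℝ) : ℂ) := by
  constructor
  · simp only [h, if_true, mul_one, Prod.mk.injEq, and_self, Finset.sum_add_distrib]
    simp
    ring
  · simp only [Matrix.trace, Matrix.diag, h, Finset.sum_add_distrib, if_true, mul_one]
    rw [Fintype.sum_prod_type]
    simp
    ring

theorem posSemidef_of_isotropic {d : ℕ} {α γ : ℝ} (hα : 0 ≤ α) (hγ : 0 ≤ γ)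
    {σ : Matrix (Fin d × Fin d) (Fin d × Fin d) ℂ}
    (h : ∀ x y, σ x y = (α : ℂ) * ((if x.1 = x.2 then 1 else 0) * (if y.1 = y.2 then 1 else 0)) +
      (γ : ℂ) * (if x = y then 1 else 0)) : σ.PosSemidef := by
  let φ : Fin d × Fin d → ℂ := fun x => if x.1 = x.2 then 1 else 0
  have hσ : σ = (α : ℂ) • Matrix.vecMulVec φ (star φ) + (γ : ℂ) • 1 := by
    ext x y
    rw [h]
    simp only [Matrix.add_apply, Matrix.smul_apply, Matrix.vecMulVec_apply, Matrix.one_apply,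
      Pi.star_apply, smul_eq_mul, φ, apply_ite (star : ℂ → ℂ), star_one, star_zero]
  rw [hσ]
  exact ((Matrix.posSemidef_vecMulVec_self_star φ).smul (by exact_mod_cast hα)).add
    (Matrix.PosSemidef.one.smul (by exact_mod_cast hγ))

/-! ### Certification and conclusion -/

theorem isDensityMatrix_idTensor {a b : Type*} [Fintype a] [Fintype b] {r : ℕ}
    {Λ : Matrix a a ℂ →ₗ[ℂ] Matrix b b ℂ} (hΛ : IsChannel Λ)
    {ω : Matrix (Fin r × a) (Fin r × a) ℂ} (hω : IsDensityMatrix ω) :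
    IsDensityMatrix (idTensor (Fin r) Λ ω) := by
  refine ⟨hΛ.1 r ω hω.1, ?_⟩
  rw [← hω.2, Matrix.trace, Matrix.trace, Fintype.sum_prod_type, Fintype.sum_prod_type]
  refine Finset.sum_congr rfl fun i _ => ?_
  exact hΛ.2 (Matrix.of fun x y => ω (i, x) (i, y))

/-- An ensemble with an outcome whose overlap with the maximally entangled state exceeds the bound
for Schmidt number `k` certifies channels that are not `k`-partially entanglement breaking. -/
theorem certifiesNotPEB_of_lt {d k : ℕ} {o : Type} [Fintype o]
    {σ : o → Matrix (Fin d × Fin d) (Fin d × Fin d) ℂ} {i : o}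
    (h : k * (σ i).trace.re < (∑ x, ∑ y, σ i (x, x) (y, y)).re) : CertifiesNotPEB k σ := by
  intro a b c b' ω₁ ω₂ Λ₁ Λ₂ M h₁ h₂ hΛ₁ hΛ₂ hM hσ
  have hd₁ := isDensityMatrix_idTensor hΛ₁ h₁
  have hd₂ := isDensityMatrix_idTensor hΛ₂ h₂
  refine ⟨fun hP => h.not_ge ?_, fun hP => h.not_ge ?_⟩
  · rw [← hσ]
    exact (IsSchmidtMixture.endpointEnsemble_left
      (IsSchmidtMixture.of_schmidtNumber_le hd₁ (hP d ω₁ h₁)) hd₂.1 (hM.1 i)).sum_diag_le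
  · rw [← hσ]
    exact (IsSchmidtMixture.endpointEnsemble_right hd₁.1
      (IsSchmidtMixture.of_schmidtNumber_le hd₂ (hP d ω₂ h₂)) (hM.1 i)).sum_diag_le

theorem lt_schmidtNumber_of_lt {d k : ℕ} {σ : Matrix (Fin d × Fin d) (Fin d × Fin d) ℂ}
    (hσ : σ.PosSemidef) (h0 : σ.trace ≠ 0)
    (h : k * σ.trace.re < (∑ x, ∑ y, σ (x, x) (y, y)).re) :
    k < schmidtNumber (σ.trace⁻¹ • σ) := by
  have htr : σ.trace = (σ.trace.re : ℂ) :=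
    Complex.eq_re_of_ofReal_le (r := 0) (by simpa using hσ.trace_nonneg)
  have hre : 0 ≤ σ.trace.re := (Complex.nonneg_iff.mp hσ.trace_nonneg).1
  have hpos : 0 < σ.trace.re := lt_of_le_of_ne hre fun h => h0 (by rw [htr, ← h]; simp)
  by_contra hk
  have hden : IsDensityMatrix (σ.trace⁻¹ • σ) := by
    refine ⟨hσ.smul ?_, by rw [Matrix.trace_smul, smul_eq_mul, inv_mul_cancel₀ h0]⟩
    rw [htr, ← Complex.ofReal_inv]
    exact_mod_cast inv_nonneg.mpr hre
  have h1 := (IsSchmidtMixture.of_schmidtNumber_le hden (not_lt.mp hk)).sum_diag_le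
  rw [hden.2] at h1
  simp only [Matrix.smul_apply, smul_eq_mul, ← Finset.mul_sum] at h1
  rw [htr, ← Complex.ofReal_inv, Complex.re_ofReal_mul, Complex.one_re, mul_one,
    inv_mul_le_iff₀ hpos, mul_comm] at h1
  exact h.not_ge h1

theorem mainTheorem11 (d k : ℕ) (hk : 1 ≤ k) (hkd : k < d) :
    ∃ Λ : Matrix (Fin d) (Fin d) ℂ →ₗ[ℂ] Matrix (Fin (d + 1)) (Fin (d + 1)) ℂ,
      IsChannel Λ ∧ IncompatibilityBreaking Λ ∧
      ∃ (n : ℕ) (M : Fin n → Matrix (Fin (d + 1) × Fin (d + 1)) (Fin (d + 1) × Fin (d + 1)) ℂ)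
        (σ : Fin n → Matrix (Fin d × Fin d) (Fin d × Fin d) ℂ),
        IsPOVM M ∧
        σ = endpointEnsemble (idTensor (Fin d) Λ (maxEntangled d))
          (idTensor (Fin d) Λ (maxEntangled d)) M ∧
        (∃ i, (σ i).trace ≠ 0 ∧ k < schmidtNumber ((σ i).trace⁻¹ • σ i)) ∧
        CertifiesNotPEB k σ := by
  have hd : 2 ≤ d := by omega
  have hdR : (2 : ℝ) ≤ d := by exact_mod_cast hd
  have hd0 : (0 : ℝ) < d := by linarith
  obtain ⟨u, v, w, hu, hv, hw, hvu, hsum, hIB⟩ :=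
    -- With v ≤ u/(4d²) one has d v² ≤ u v, so (2uv + d v²) d² ≤ 3 u v d² ≤ (3/4) u², which is the
    -- strict inequality `hsmall`.
    exists_incompatibilityBreaking hd (ε := 1 / (4 * d ^ 2)) (by positivity)
  refine ⟨lossyDepolarizing d u v w, isChannel_lossyDepolarizing hu.le hv hw hsum, hIB, 2,
    ![bellProjection d, 1 - bellProjection d], _, isPOVM_bellProjection (by omega), rfl, ?_⟩
  have hiso := endpointEnsemble_lossyDepolarizing d u v w (1 - bellProjection d)
  have hα : 0 < u ^ 2 / d ^ 3 := by positivity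
  have hγ : 0 ≤ (2 * u * v + d * v ^ 2) / d ^ 3 := by positivity
  obtain ⟨hdiag, htr⟩ := sum_diag_and_trace_of_isotropic hiso
  have hsmall : (2 * u * v + d * v ^ 2) * d ^ 2 < u ^ 2 := by
    have h1 : 4 * (d : ℝ) ^ 2 * v ≤ u := by
      rw [one_div, inv_mul_eq_div, le_div_iff₀ (by positivity)] at hvu
      linarith
    have h2 : (d : ℝ) * v ≤ u := by
      have := mul_nonneg (mul_nonneg hd0.le hv) (by linarith : (0 : ℝ) ≤ 4 * d - 1)
      linarith
    have h3 : (d : ℝ) * v ^ 2 ≤ u * v := by nlinarith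
    have h4 : 4 * (d : ℝ) ^ 2 * v * u ≤ u * u := mul_le_mul_of_nonneg_right h1 hu.le
    nlinarith [mul_pos hu hu, sq_nonneg (d : ℝ)]
  have hlt : (k : ℝ) * (u ^ 2 / d ^ 3 * d + (2 * u * v + d * v ^ 2) / d ^ 3 * d ^ 2) <
      u ^ 2 / d ^ 3 * d ^ 2 + (2 * u * v + d * v ^ 2) / d ^ 3 * d := by
    -- For k = d - 1 the left side is A d² - A d + C d³ - C d², and C d² < A makes it smaller than A
    -- d².
    have hk' : (k : ℝ) ≤ d - 1 := by
      have : (k : ℝ) + 1 ≤ d := by exact_mod_cast hkd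
      linarith
    set A := u ^ 2 / (d : ℝ) ^ 3 with hA
    set C := (2 * u * v + d * v ^ 2) / (d : ℝ) ^ 3 with hC
    have hCA : C * d ^ 2 < A := by
      rw [hA, hC, div_mul_eq_mul_div]
      exact div_lt_div_of_pos_right hsmall (by positivity)
    have h1 : (k : ℝ) * (A * d + C * d ^ 2) ≤ (d - 1) * (A * d + C * d ^ 2) :=
      mul_le_mul_of_nonneg_right hk' (by positivity)
    have h2 : C * d ^ 2 * d < A * d := mul_lt_mul_of_pos_right hCA hd0
    have h3 : 0 ≤ C * d ^ 2 := by positivity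
    have h4 : 0 ≤ C * d := by positivity
    linarith
  have hbound := hlt
  rw [← Complex.ofReal_re (u ^ 2 / d ^ 3 * d ^ 2 + _), ← hdiag,
    ← Complex.ofReal_re (u ^ 2 / d ^ 3 * d + _), ← htr] at hbound
  have htr0 : (endpointEnsemble (idTensor (Fin d) (lossyDepolarizing d u v w) (maxEntangled d))
      (idTensor (Fin d) (lossyDepolarizing d u v w) (maxEntangled d))
      ![bellProjection d, 1 - bellProjection d] 0).trace ≠ 0 := by
    rw [htr, Complex.ofReal_ne_zero]
    positivity
  exact ⟨⟨0, htr0, lt_schmidtNumber_of_lt (posSemidef_of_isotropic hα.le hγ hiso) htr0 hbound⟩,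
    certifiesNotPEB_of_lt hbound⟩
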